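/- **Setting.** Vector norms are Euclidean, matrix norms $\|\cdot\|$ are the induced ones, $\|\cdot\|_F$ is the Frobenius norm. The plant is $\dot x_p=A_px_p+B_p\Lambda B_{sat}(u)$ with $x_p\in\mathbb R^{n_x}$, $u\in\mathbb R^{n_u}$, $\Lambda=\mathrm{diag}(\lambda)$ with positive entries, and $B_{sat}(u)=u$ if $\|u\|\le u_{max}$, $B_{sat}(u)=\frac{u_{max}}{\|u\|}u$ otherwise ($u_{max}>0$). The reference model is $\dot x_m=A_mx_m+B_mr$ with $A_m$ Hurwitz, $B_m$ of full column rank and $\|r\|\le r_{max}$. There are ideal gains $K_x,K_r$ with $A_p+B_p\Lambda K_x=A_m$, $B_p\Lambda K_r=B_m$. The controller is $u=\widehat\Theta\Phi$, $\Phi=[x_p^T,r^T]^T$. Put $\Delta u=B_{sat}(u)-u$, $e=x_p-x_m$, $\dot e_\Delta=A_me_\Delta+B_p\,\mathrm{diag}(\hat\lambda)\Delta u$, $e_u=e-e_\Delta$, $\Phi_a=[\Phi^T,-\Delta u^T]^T$, $\Theta=[K_x,K_r]$, $\Theta_a=[\Theta,\Lambda]$, $\widehat\Theta_a=[\widehat\Theta,\mathrm{diag}(\hat\lambda)]$,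 $\Xi_a=[\Xi,\mathrm{diag}(\lambda_\epsilon)]$. The high-order tuner is $$\dot\Xi_a=-\gamma B_p^TPe_u\Phi_a^T,\qquad \dot{\widehat\Theta}_a=-\beta(\widehat\Theta_a-\Xi_a)\mathcal N_t,\qquad \mathcal N_t=1+\mu\Phi_a^T\Phi_a,$$ where in the last, diagonal, block only the diagonal entries are updated. Here $\gamma,\beta>0$, $\mu\ge\frac{2\gamma}{\beta}\|PB_p\|_F^2$, $P,Q$ are symmetric positive definite with $A_m^TP+PA_m=-Q$, and $Q$ is scaled so that $\lambda_{\min}(Q)\ge 1+\lambda_{\max}(\Lambda)$. With $\Lambda_a=\mathrm{blockdiag}(\Lambda,I)$ let $$V=e_u^TPe_u+\tfrac1\gamma\Big(\mathrm{Tr}[(\Xi-\Theta)^T\Lambda(\Xi-\Theta)]+\|\lambda_\epsilon-\lambda\|^2\Big)+\tfrac1\gamma\Big(\mathrm{Tr}[(\widehat\Theta-\Xi)^T\Lambda(\widehat\Theta-\Xi)]+\|\hat\lambda-\lambda_\epsilon\|^2\Big).$$ Let $q_{min},p_{min},p_{max}$ be the extreme eigenvalues of $Q$ and $P$, $\lambda_{min}=\min\mathrm{eig}(\Lambda_a)$,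 $\rho=\sqrt{p_{max}/p_{min}}$, $P_B=\|PB_p\Lambda\|$. For a trajectory on $[t_0,T)$, $t_0<T\le\infty$ (continuous states, equations valid off a countable set of times), let $K_{max}=\sup_{t\in[t_0,T)}\|\widehat\Theta_a(t)-\Theta_a\|_F$ and $$a_0=\frac{u_{max}K_{max}}{\|K_x\|+K_{max}},\qquad x_{max}=\frac{P_Ba_0}{|q_{min}-2P_B\|K_x\||},$$ $$\bar K_{max}=\frac{q_{min}-\frac{\rho}{a_0}\left(3\|K_r\|r_{max}+2u_{max}\right)\,|q_{min}-2P_B\|K_x\||}{3P_B+\frac{3\rho}{a_0}(r_{max}+1)\,|q_{min}-2P_B\|K_x\||}$$ (these presuppose $K_{max}>0$ and $q_{min}\ne2P_B\|K_x\|$). **Theorem.** There is a constant $C\ge0$, depending only on the plant, the reference model and the design constants, such that for every trajectory of the closed loop on $[t_0,T)$: $K_{max}$ is finite; and if 1. $\|x_p(t_0)\|<x_{max}/\rho$, and 2. $\sqrt{V(t_0)}<\bar K_{max}\sqrt{\lambda_{min}/\gamma}$, then $x_p,x_m,e_\Delta,\widehat\Theta_a,\Xi_a,u$ are bounded on $[t_0,T)$,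 $\|x_p(t)\|<x_{max}$ for all $t\in[t_0,T)$, and the tracking error is asymptotically of the order of $\sup_{\tau\le t}\|\Delta u(\tau)\|$: there is a function $\varepsilon$ with $\varepsilon(t)\to0$ as $t\to\infty$ such that $$\|x_p(t)-x_m(t)\|\le\varepsilon(t)+C\sup_{t_0\le\tau\le t}\|\Delta u(\tau)\|\qquad\text{for all }t\in[t_0,T).$$ -/

import Mathlib

open Filter Topology Matrix

noncomputable section

/-- Euclidean norm of a vector. -/
def euclNorm {ι : Type*} [Fintype ι] (v : ι → ℝ) : ℝ := √(∑ i, v i ^ 2)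

/-- Frobenius norm of a matrix. -/
def frobNorm {ι κ : Type*} [Fintype ι] [Fintype κ] (A : Matrix ι κ ℝ) : ℝ :=
  √(∑ i, ∑ j, A i j ^ 2)

open scoped Matrix.Norms.L2Operator in
/-- Matrix norm induced by the Euclidean vector norms. -/
def specNorm {ι κ : Type*} [Fintype ι] [Fintype κ] [DecidableEq κ] (A : Matrix ι κ ℝ) : ℝ := ‖A‖

/-- Smallest eigenvalue (used for symmetric matrices only). -/
def minEig {ι : Type*} [Fintype ι] [DecidableEq ι] (A : Matrix ι ι ℝ) : ℝ := sInf (spectrum ℝ A)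

/-- Largest eigenvalue (used for symmetric matrices only). -/
def maxEig {ι : Type*} [Fintype ι] [DecidableEq ι] (A : Matrix ι ι ℝ) : ℝ := sSup (spectrum ℝ A)

/-- All complex eigenvalues have negative real part. -/
def IsHurwitz {n : ℕ} (A : Matrix (Fin n) (Fin n) ℝ) : Prop :=
  ∀ z ∈ spectrum ℂ (A.map (fun a : ℝ => (a : ℂ))), z.re < 0

/-- Saturation of the input by the centred ball of radius `uMax`. -/
def ballSat {n : ℕ} (uMax : ℝ) (u : Fin n → ℝ) : Fin n → ℝ :=
  if euclNorm u ≤ uMax then u else (uMax / euclNorm u) • u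

/-- The half-open time interval `[t0, T)`, where `T = ⊤` gives `[t0, ∞)`. -/
def timeDomain (t0 : ℝ) (T : EReal) : Set ℝ := {t | t0 ≤ t ∧ (t : EReal) < T}

/-- Plant, reference model, ideal gains and design constants. -/
structure MSACSystem (nx nu : ℕ) where
  Ap : Matrix (Fin nx) (Fin nx) ℝ
  Bp : Matrix (Fin nx) (Fin nu) ℝ
  /-- the diagonal entries of `Λ` -/
  lam : Fin nu → ℝ
  uMax : ℝ
  Am : Matrix (Fin nx) (Fin nx) ℝ
  Bm : Matrix (Fin nx) (Fin nu) ℝ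
  rMax : ℝ
  Kx : Matrix (Fin nu) (Fin nx) ℝ
  Kr : Matrix (Fin nu) (Fin nu) ℝ
  P : Matrix (Fin nx) (Fin nx) ℝ
  Q : Matrix (Fin nx) (Fin nx) ℝ
  gam : ℝ
  bet : ℝ
  mu : ℝ

/-- The signals of the closed loop: states of plant, reference model, auxiliary error and
estimators, and the reference input. -/
structure MSACSignals (nx nu : ℕ) where
  xp : ℝ → Fin nx → ℝ
  xm : ℝ → Fin nx → ℝ
  eDelta : ℝ → Fin nx → ℝ
  /-- `Θ̂ = [K̂_x, K̂_r]` -/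
  ThetaHat : ℝ → Matrix (Fin nu) (Fin nx ⊕ Fin nu) ℝ
  /-- `λ̂` -/
  lamHat : ℝ → Fin nu → ℝ
  /-- the block `Ξ` of `Ξ_a = [Ξ, diag(λ_ε)]` -/
  Xi : ℝ → Matrix (Fin nu) (Fin nx ⊕ Fin nu) ℝ
  /-- the vector `λ_ε` of `Ξ_a = [Ξ, diag(λ_ε)]` -/
  lamEps : ℝ → Fin nu → ℝ
  r : ℝ → Fin nu → ℝ

namespace MSACSystem

variable {nx nu : ℕ} (S : MSACSystem nx nu)

/-- `Λ` -/
def Lam : Matrix (Fin nu) (Fin nu) ℝ := Matrix.diagonal S.lam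

/-- `Λ_a` -/
def LamA : Matrix (Fin nu ⊕ Fin nu) (Fin nu ⊕ Fin nu) ℝ := Matrix.fromBlocks S.Lam 0 0 1

/-- `Θ = [K_x, K_r]` -/
def Theta : Matrix (Fin nu) (Fin nx ⊕ Fin nu) ℝ := Matrix.fromCols S.Kx S.Kr

/-- `Θ_a = [Θ, Λ]` -/
def ThetaA : Matrix (Fin nu) ((Fin nx ⊕ Fin nu) ⊕ Fin nu) ℝ := Matrix.fromCols S.Theta S.Lam

def qMin : ℝ := minEig S.Q

def pMin : ℝ := minEig S.P

def pMax : ℝ := maxEig S.P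

def rho : ℝ := √(S.pMax / S.pMin)

def PB : ℝ := specNorm (S.P * S.Bp * S.Lam)

/-- Smallest eigenvalue of the weight `Λ_a`, that is, of `Λ` and of the identity block. -/
def lamMin : ℝ := minEig S.LamA

/-- Standing assumptions on plant, reference model and design constants. -/
structure Standing : Prop where
  lam_pos : ∀ i, 0 < S.lam i
  uMax_pos : 0 < S.uMax
  rMax_nonneg : 0 ≤ S.rMax
  hurwitz : IsHurwitz S.Am
  full_rank : S.Bm.rank = nu
  match_x : S.Ap + S.Bp * S.Lam * S.Kx = S.Am
  match_r : S.Bp * S.Lam * S.Kr = S.Bm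
  Q_posDef : S.Q.PosDef
  P_posDef : S.P.PosDef
  lyapunov : S.Amᵀ * S.P + S.P * S.Am = -S.Q
  gam_pos : 0 < S.gam
  bet_pos : 0 < S.bet
  mu_ge : 2 * S.gam / S.bet * frobNorm (S.P * S.Bp) ^ 2 ≤ S.mu
  Q_scale : ∀ i, 1 + S.lam i ≤ S.qMin

variable (z : MSACSignals nx nu)

/-- `Φ = [x_pᵀ, rᵀ]ᵀ` -/
def Phi (t : ℝ) : Fin nx ⊕ Fin nu → ℝ := Sum.elim (z.xp t) (z.r t)

/-- The unsaturated control `u = Θ̂ Φ`. -/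
def u (t : ℝ) : Fin nu → ℝ := z.ThetaHat t *ᵥ Phi z t

/-- `Δu = B_sat(u) - u` -/
def deltaU (t : ℝ) : Fin nu → ℝ := ballSat S.uMax (u z t) - u z t

/-- `e = x_p - x_m` -/
def err (t : ℝ) : Fin nx → ℝ := z.xp t - z.xm t

/-- `e_u = e - e_Δ` -/
def errU (t : ℝ) : Fin nx → ℝ := err z t - z.eDelta t

/-- `Φ_a = [Φᵀ, -Δuᵀ]ᵀ` -/
def PhiA (t : ℝ) : (Fin nx ⊕ Fin nu) ⊕ Fin nu → ℝ := Sum.elim (Phi z t) (-S.deltaU z t)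

/-- `𝒩_t = 1 + μ Φ_aᵀ Φ_a` -/
def normalizer (t : ℝ) : ℝ := 1 + S.mu * (S.PhiA z t ⬝ᵥ S.PhiA z t)

/-- `Θ̂_a = [Θ̂, diag(λ̂)]` -/
def ThetaHatA (t : ℝ) : Matrix (Fin nu) ((Fin nx ⊕ Fin nu) ⊕ Fin nu) ℝ :=
  Matrix.fromCols (z.ThetaHat t) (Matrix.diagonal (z.lamHat t))

/-- `Ξ_a = [Ξ, diag(λ_ε)]` -/
def XiA (t : ℝ) : Matrix (Fin nu) ((Fin nx ⊕ Fin nu) ⊕ Fin nu) ℝ :=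
  Matrix.fromCols (z.Xi t) (Matrix.diagonal (z.lamEps t))

/-- The matrix `-γ B_pᵀ P e_u Φ_aᵀ` that drives `Ξ_a`. -/
def tunerDrive (t : ℝ) : Matrix (Fin nu) ((Fin nx ⊕ Fin nu) ⊕ Fin nu) ℝ :=
  -S.gam • Matrix.vecMulVec ((S.Bpᵀ * S.P) *ᵥ errU z t) (S.PhiA z t)

/-- The closed loop at time `t`: plant, reference model, auxiliary error and high-order tuner.
The blocks `diag(λ_ε)` and `diag(λ̂)` are diagonal, so the tuner law acts on their diagonals. -/
structure LoopAt (t : ℝ) : Prop where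
  plant : HasDerivAt z.xp (S.Ap *ᵥ z.xp t + (S.Bp * S.Lam) *ᵥ ballSat S.uMax (u z t)) t
  reference : HasDerivAt z.xm (S.Am *ᵥ z.xm t + S.Bm *ᵥ z.r t) t
  auxiliary : HasDerivAt z.eDelta
    (S.Am *ᵥ z.eDelta t + (S.Bp * Matrix.diagonal (z.lamHat t)) *ᵥ S.deltaU z t) t
  xi : ∀ i j, HasDerivAt (fun s => z.Xi s i j) (S.tunerDrive z t i (Sum.inl j)) t
  lamEps : ∀ i, HasDerivAt (fun s => z.lamEps s i) (S.tunerDrive z t i (Sum.inr i)) t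
  thetaHat : ∀ i j, HasDerivAt (fun s => z.ThetaHat s i j)
    (-S.bet * (z.ThetaHat t i j - z.Xi t i j) * S.normalizer z t) t
  lamHat : ∀ i, HasDerivAt (fun s => z.lamHat s i)
    (-S.bet * (z.lamHat t i - z.lamEps t i) * S.normalizer z t) t

/-- `z` is a trajectory of the closed loop on `[t0, T)`: the reference input is bounded by `rMax`,
the states are continuous, and the differential equations hold outside a countable set of times
(such as the jumps of a piecewise continuous reference input). -/
structure IsTrajectory (t0 : ℝ) (T : EReal) : Prop where
  r_le : ∀ t ∈ timeDomain t0 T, euclNorm (z.r t) ≤ S.rMax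
  xp_cont : ContinuousOn z.xp (timeDomain t0 T)
  xm_cont : ContinuousOn z.xm (timeDomain t0 T)
  eDelta_cont : ContinuousOn z.eDelta (timeDomain t0 T)
  thetaHat_cont : ContinuousOn z.ThetaHat (timeDomain t0 T)
  lamHat_cont : ContinuousOn z.lamHat (timeDomain t0 T)
  xi_cont : ContinuousOn z.Xi (timeDomain t0 T)
  lamEps_cont : ContinuousOn z.lamEps (timeDomain t0 T)
  loop : ∃ E : Set ℝ, E.Countable ∧ ∀ t ∈ timeDomain t0 T \ E, S.LoopAt z t

/-- `Tr[Mᵀ Λ_a M]` for a parameter deviation `[M₁, diag(v)]`, arranged block-diagonally so that it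
is conformable with `Λ_a`. -/
def weightedTrace (M₁ : Matrix (Fin nu) (Fin nx ⊕ Fin nu) ℝ) (v : Fin nu → ℝ) : ℝ :=
  let M : Matrix (Fin nu ⊕ Fin nu) ((Fin nx ⊕ Fin nu) ⊕ Fin nu) ℝ :=
    Matrix.fromBlocks M₁ 0 0 (Matrix.diagonal v)
  (Mᵀ * S.LamAᵀ * M).trace

/-- The Lyapunov function `V` along the trajectory. -/
def V (t : ℝ) : ℝ :=
  errU z t ⬝ᵥ (S.P *ᵥ errU z t)
    + 1 / S.gam * S.weightedTrace (z.Xi t - S.Theta) (z.lamEps t - S.lam)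
    + 1 / S.gam * S.weightedTrace (z.ThetaHat t - z.Xi t) (z.lamHat t - z.lamEps t)

/-- `K_max`, the supremum of the norm of `Θ̂_a - Θ_a` along the trajectory. -/
def KMax (t0 : ℝ) (T : EReal) : ℝ :=
  ⨆ t : timeDomain t0 T, frobNorm (ThetaHatA z t - S.ThetaA)

/-- `a₀`, as a function of `K_max` -/
def a0 (K : ℝ) : ℝ := S.uMax * K / (specNorm S.Kx + K)

/-- `x_max`, as a function of `K_max` -/
def xMax (K : ℝ) : ℝ := S.PB * S.a0 K / |S.qMin - 2 * S.PB * specNorm S.Kx|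

/-- `K̄_max`, as a function of `K_max` -/
def KBar (K : ℝ) : ℝ :=
  (S.qMin - S.rho / S.a0 K * (3 * specNorm S.Kr * S.rMax + 2 * S.uMax)
      * |S.qMin - 2 * S.PB * specNorm S.Kx|)
    / (3 * S.PB + 3 * S.rho / S.a0 K * (S.rMax + 1) * |S.qMin - 2 * S.PB * specNorm S.Kx|)

end MSACSystem

end

/-! The argument has three layers, and their order avoids circularity: the parameter errors are
bounded before anything is known about `x_p`.

Lyapunov layer. Subtracting `e_Δ` from the tracking error removes the saturation deficiency from the
error equation except through a mismatch that is linear in the parameter errors. In the derivative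
of `V` the part of the mismatch belonging to `Ξ_a - Θ_a` cancels. The part belonging to `Θ̂_a - Ξ_a`
is absorbed by the normalized damping of the tuner (condition on `μ`) and by the margin in the
scaling of `Q`. So `V' ≤ -c ‖e_u‖²` (`LoopAt.exists_hasDerivAt_V`), which bounds `e_u` and the
parameters and makes `K_max` finite. Splitting `Θ̂_a - Θ_a` through `Ξ_a` costs a factor `√2`:
hypothesis 2 yields only `K_max < √2 · KBar`. The factors `3` in `KBar` leave room for this.

Invariance layer. The form `x_pᵀ P x_p` strictly decreases while its value lies just below `p_max
(x_max/ρ)² = p_min x_max²`, so it never reaches that level. If `q_min > 2 P_B ‖K_x‖`, the saturated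
input is a convex combination of the full input and zero input, and both give decrease. Otherwise
zero input may fail, and the saturated push must have the right direction. When the ideal feedback
is almost as destabilizing to omit as it can be, it is almost aligned with the gradient direction,
and the perturbed feedback stays in a cone about that direction. A push of length `u_max` then
suffices (`saturated_decrease`, resting on `norm_add_lt_four_mul_inner`).

Asymptotic layer. With `x_p` bounded all signals are bounded. A Barbalat argument gives `e_u → 0`
when `T = ∞`, and `e_Δ` obeys an input-to-state estimate driven by `Δu`. The gain `C` is uniform
over trajectories because the hypotheses force `K_max ≤ q_min / P_B` (`IsTrajectory.KMax_le`). -/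

noncomputable section

/-! ### Euclidean, Frobenius and induced norms -/

section Norms

variable {ι κ : Type*} [Fintype ι] [Fintype κ]

lemma euclNorm_eq_norm (v : ι → ℝ) : euclNorm v = ‖WithLp.toLp 2 v‖ := by
  simp [euclNorm, EuclideanSpace.norm_eq]

lemma euclNorm_nonneg (v : ι → ℝ) : 0 ≤ euclNorm v := Real.sqrt_nonneg _

lemma euclNorm_sq (v : ι → ℝ) : euclNorm v ^ 2 = v ⬝ᵥ v := by
  rw [euclNorm, Real.sq_sqrt (Finset.sum_nonneg fun i _ => sq_nonneg _), dotProduct]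
  exact Finset.sum_congr rfl fun i _ => sq _

lemma euclNorm_add_le (v w : ι → ℝ) : euclNorm (v + w) ≤ euclNorm v + euclNorm w := by
  simpa only [euclNorm_eq_norm, WithLp.toLp_add] using norm_add_le _ _

lemma euclNorm_sub_le (v w : ι → ℝ) : euclNorm (v - w) ≤ euclNorm v + euclNorm w := by
  simpa only [euclNorm_eq_norm, WithLp.toLp_sub] using norm_sub_le _ _

lemma euclNorm_smul (c : ℝ) (v : ι → ℝ) : euclNorm (c • v) = |c| * euclNorm v := by
  simp only [euclNorm_eq_norm, WithLp.toLp_smul, norm_smul, Real.norm_eq_abs]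

lemma abs_dotProduct_le (v w : ι → ℝ) : |v ⬝ᵥ w| ≤ euclNorm v * euclNorm w := by
  have h := abs_real_inner_le_norm (WithLp.toLp 2 w) (WithLp.toLp 2 v)
  rw [EuclideanSpace.inner_toLp_toLp] at h
  simpa [euclNorm_eq_norm, mul_comm] using h

lemma dotProduct_le (v w : ι → ℝ) : v ⬝ᵥ w ≤ euclNorm v * euclNorm w :=
  (le_abs_self _).trans (abs_dotProduct_le v w)

lemma euclNorm_sumElim_le (v : ι → ℝ) (w : κ → ℝ) :
    euclNorm (Sum.elim v w) ≤ euclNorm v + euclNorm w := by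
  have h : euclNorm (Sum.elim v w) ^ 2 = euclNorm v ^ 2 + euclNorm w ^ 2 := by
    simp [euclNorm_sq, dotProduct]
  have h1 := euclNorm_nonneg v
  have h2 := euclNorm_nonneg w
  exact abs_le_of_sq_le_sq' (by nlinarith) (by positivity) |>.2

lemma abs_apply_le_euclNorm (v : ι → ℝ) (i : ι) : |v i| ≤ euclNorm v := by
  rw [euclNorm]
  refine Real.abs_le_sqrt ?_
  exact Finset.single_le_sum (f := fun i => v i ^ 2) (fun i _ => sq_nonneg _) (Finset.mem_univ i)

lemma euclNorm_mul_le {c : ℝ} {v : ι → ℝ} (hv : ∀ i, |v i| ≤ c) (hc : 0 ≤ c) (w : ι → ℝ) :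
    euclNorm (v * w) ≤ c * euclNorm w := by
  refine abs_le_of_sq_le_sq' ?_ (mul_nonneg hc (euclNorm_nonneg w)) |>.2
  rw [mul_pow, euclNorm_sq, euclNorm_sq, dotProduct, dotProduct, Finset.mul_sum]
  refine Finset.sum_le_sum fun i _ => ?_
  have : v i ^ 2 ≤ c ^ 2 := sq_le_sq' (abs_le.1 (hv i)).1 (abs_le.1 (hv i)).2
  simp only [Pi.mul_apply]
  nlinarith [mul_le_mul_of_nonneg_right this (sq_nonneg (w i))]

lemma frobNorm_nonneg (A : Matrix ι κ ℝ) : 0 ≤ frobNorm A := Real.sqrt_nonneg _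

lemma frobNorm_sq (A : Matrix ι κ ℝ) : frobNorm A ^ 2 = ∑ i, ∑ j, A i j ^ 2 := by
  rw [frobNorm, Real.sq_sqrt]
  exact Finset.sum_nonneg fun i _ => Finset.sum_nonneg fun j _ => sq_nonneg _

lemma frobNorm_transpose (A : Matrix ι κ ℝ) : frobNorm Aᵀ = frobNorm A := by
  rw [frobNorm, frobNorm, Finset.sum_comm]
  rfl

lemma frobNorm_add_le (A B : Matrix ι κ ℝ) : frobNorm (A + B) ≤ frobNorm A + frobNorm B := by
  have key : ∀ C : Matrix ι κ ℝ, frobNorm C = euclNorm (fun p : ι × κ => C p.1 p.2) := by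
    intro C
    rw [frobNorm, euclNorm, Fintype.sum_prod_type]
  rw [key, key, key]
  exact euclNorm_add_le (fun p : ι × κ => A p.1 p.2) (fun p : ι × κ => B p.1 p.2)

lemma euclNorm_mulVec_le_frobNorm (A : Matrix ι κ ℝ) (v : κ → ℝ) :
    euclNorm (A *ᵥ v) ≤ frobNorm A * euclNorm v := by
  refine abs_le_of_sq_le_sq' ?_ (mul_nonneg (frobNorm_nonneg A) (euclNorm_nonneg v)) |>.2
  rw [mul_pow, frobNorm_sq, euclNorm_sq (A *ᵥ v), dotProduct, Finset.sum_mul]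
  refine Finset.sum_le_sum fun i _ => ?_
  have h := abs_dotProduct_le (A i) v
  have h2 : (A i ⬝ᵥ v) ^ 2 ≤ (euclNorm (A i) * euclNorm v) ^ 2 :=
    sq_le_sq' (abs_le.1 h).1 (abs_le.1 h).2
  rw [mul_pow, euclNorm_sq (A i)] at h2
  calc _ = (A i ⬝ᵥ v) ^ 2 := (sq _).symm
    _ ≤ _ := h2
    _ = _ := by simp only [sq, dotProduct]

open scoped Matrix.Norms.L2Operator in
lemma euclNorm_mulVec_le_specNorm [DecidableEq κ] (A : Matrix ι κ ℝ) (v : κ → ℝ) :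
    euclNorm (A *ᵥ v) ≤ specNorm A * euclNorm v := by
  rw [euclNorm_eq_norm, euclNorm_eq_norm, specNorm]
  exact Matrix.l2_opNorm_mulVec A (WithLp.toLp 2 v)

open scoped Matrix.Norms.L2Operator in
lemma specNorm_nonneg [DecidableEq κ] (A : Matrix ι κ ℝ) : 0 ≤ specNorm A := norm_nonneg A

lemma dotProduct_mulVec_eq (A : Matrix ι κ ℝ) (v : ι → ℝ) (w : κ → ℝ) :
    v ⬝ᵥ A *ᵥ w = Aᵀ *ᵥ v ⬝ᵥ w := by
  rw [dotProduct_mulVec, mulVec_transpose]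

/-- Pairing gives `‖Aᵀv‖² = v · A(Aᵀv) ≤ ‖v‖ ‖A‖ ‖Aᵀv‖`, and one factor cancels. -/
lemma euclNorm_transpose_mulVec_le [DecidableEq κ] (A : Matrix ι κ ℝ) (v : ι → ℝ) :
    euclNorm (Aᵀ *ᵥ v) ≤ specNorm A * euclNorm v := by
  rcases (euclNorm_nonneg (Aᵀ *ᵥ v)).eq_or_lt with h0 | h0
  · rw [← h0]; exact mul_nonneg (specNorm_nonneg A) (euclNorm_nonneg v)
  · have h1 : euclNorm (Aᵀ *ᵥ v) ^ 2 = v ⬝ᵥ A *ᵥ (Aᵀ *ᵥ v) := by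
      rw [euclNorm_sq, dotProduct_mulVec_eq A]
    have h2 := dotProduct_le v (A *ᵥ (Aᵀ *ᵥ v))
    have h3 := mul_le_mul_of_nonneg_left (euclNorm_mulVec_le_specNorm A (Aᵀ *ᵥ v))
      (euclNorm_nonneg v)
    nlinarith

end Norms

/-! ### Extreme eigenvalues and quadratic forms -/

section Eigenvalues

variable {ι : Type*} [Fintype ι] [DecidableEq ι]

lemma Matrix.IsHermitian.finite_spectrum {A : Matrix ι ι ℝ} (hA : A.IsHermitian) :
    (spectrum ℝ A).Finite := by
  rw [hA.spectrum_real_eq_range_eigenvalues]; exact Set.finite_range _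

lemma Matrix.IsHermitian.mem_spectrum_eigenvalues {A : Matrix ι ι ℝ} (hA : A.IsHermitian) (i : ι) :
    hA.eigenvalues i ∈ spectrum ℝ A := by
  rw [hA.spectrum_real_eq_range_eigenvalues]; exact ⟨i, rfl⟩

/-- Spectral decomposition of a real quadratic form. -/
lemma Matrix.IsHermitian.exists_quadForm_eq {A : Matrix ι ι ℝ} (hA : A.IsHermitian) (x : ι → ℝ) :
    ∃ y : ι → ℝ, x ⬝ᵥ x = ∑ i, y i ^ 2 ∧ x ⬝ᵥ A *ᵥ x = ∑ i, hA.eigenvalues i * y i ^ 2 := by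
  set U : Matrix ι ι ℝ := (hA.eigenvectorUnitary : Matrix ι ι ℝ) with hU
  have hUU : U * Uᵀ = 1 := by
    have := (Matrix.mem_unitaryGroup_iff).1 hA.eigenvectorUnitary.2
    simpa [Matrix.star_eq_conjTranspose] using this
  have hspec : A = U * diagonal hA.eigenvalues * Uᵀ := by
    have := hA.spectral_theorem
    simpa [Matrix.star_eq_conjTranspose, Unitary.conjStarAlgAut_apply, Function.comp_def] using this
  refine ⟨Uᵀ *ᵥ x, ?_, ?_⟩
  · have : x ⬝ᵥ x = Uᵀ *ᵥ x ⬝ᵥ Uᵀ *ᵥ x := by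
      rw [← dotProduct_mulVec_eq, mulVec_mulVec, hUU, one_mulVec]
    rw [this, dotProduct]
    exact Finset.sum_congr rfl fun i _ => (sq _).symm
  · have : x ⬝ᵥ A *ᵥ x = Uᵀ *ᵥ x ⬝ᵥ diagonal hA.eigenvalues *ᵥ (Uᵀ *ᵥ x) := by
      conv_lhs => rw [hspec]
      rw [← mulVec_mulVec, ← mulVec_mulVec, dotProduct_mulVec_eq]
    rw [this, dotProduct]
    refine Finset.sum_congr rfl fun i _ => ?_
    rw [mulVec_diagonal]; ring

lemma Matrix.IsHermitian.minEig_mul_le {A : Matrix ι ι ℝ} (hA : A.IsHermitian) (x : ι → ℝ) :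
    minEig A * euclNorm x ^ 2 ≤ x ⬝ᵥ A *ᵥ x := by
  obtain ⟨y, h1, h2⟩ := hA.exists_quadForm_eq x
  rw [euclNorm_sq, h1, h2, Finset.mul_sum]
  refine Finset.sum_le_sum fun i _ => mul_le_mul_of_nonneg_right ?_ (sq_nonneg _)
  exact csInf_le hA.finite_spectrum.bddBelow (hA.mem_spectrum_eigenvalues i)

lemma Matrix.IsHermitian.le_maxEig_mul {A : Matrix ι ι ℝ} (hA : A.IsHermitian) (x : ι → ℝ) :
    x ⬝ᵥ A *ᵥ x ≤ maxEig A * euclNorm x ^ 2 := by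
  obtain ⟨y, h1, h2⟩ := hA.exists_quadForm_eq x
  rw [euclNorm_sq, h1, h2, Finset.mul_sum]
  refine Finset.sum_le_sum fun i _ => mul_le_mul_of_nonneg_right ?_ (sq_nonneg _)
  exact le_csSup hA.finite_spectrum.bddAbove (hA.mem_spectrum_eigenvalues i)

lemma Matrix.PosDef.minEig_pos [Nonempty ι] {A : Matrix ι ι ℝ} (hA : A.PosDef) : 0 < minEig A := by
  have hne : (spectrum ℝ A).Nonempty :=
    ⟨_, hA.isHermitian.mem_spectrum_eigenvalues (Classical.arbitrary ι)⟩
  have hmem : minEig A ∈ spectrum ℝ A := hne.csInf_mem hA.isHermitian.finite_spectrum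
  rw [hA.isHermitian.spectrum_real_eq_range_eigenvalues] at hmem
  obtain ⟨i, hi⟩ := hmem
  rw [← hi]
  exact hA.eigenvalues_pos i

lemma Matrix.IsHermitian.minEig_le_diag {A : Matrix ι ι ℝ} (hA : A.IsHermitian) (i : ι) :
    minEig A ≤ A i i := by
  have h := hA.minEig_mul_le (Pi.single i 1)
  rw [euclNorm_sq] at h
  simpa using h

/-- Covers dimension zero, where the spectrum is empty and `minEig` takes the default value `0`. -/
lemma Matrix.PosDef.exists_mul_le {A : Matrix ι ι ℝ} (hA : A.PosDef) :
    ∃ p : ℝ, 0 < p ∧ ∀ x, p * euclNorm x ^ 2 ≤ x ⬝ᵥ A *ᵥ x := by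
  rcases isEmpty_or_nonempty ι with h | h
  · exact ⟨1, one_pos, fun x => by simp [euclNorm_sq, dotProduct]⟩
  · exact ⟨minEig A, hA.minEig_pos, hA.isHermitian.minEig_mul_le⟩

lemma Matrix.IsHermitian.exists_le_mul {A : Matrix ι ι ℝ} (hA : A.IsHermitian) :
    ∃ p : ℝ, 0 < p ∧ ∀ x, x ⬝ᵥ A *ᵥ x ≤ p * euclNorm x ^ 2 := by
  refine ⟨|maxEig A| + 1, by positivity, fun x => (hA.le_maxEig_mul x).trans ?_⟩
  refine mul_le_mul_of_nonneg_right ?_ (sq_nonneg _)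
  linarith [le_abs_self (maxEig A)]

end Eigenvalues

/-! ### Differential inequalities off a countable set -/

section Calculus

open Set

/-- A continuous function that rises from `f a` to above `y` crosses the level `y` for the last
time at some interior point. -/
lemma exists_last_crossing {f : ℝ → ℝ} {a b y : ℝ} (hab : a ≤ b) (hf : ContinuousOn f (Icc a b))
    (ha : f a < y) (hb : y < f b) :
    ∃ t ∈ Ioo a b, f t = y ∧ ∀ s ∈ Ioc t b, y < f s := by
  set S : Set ℝ := {t ∈ Icc a b | f t ≤ y} with hS
  have hSc : IsClosed S := hf.preimage_isClosed_of_isClosed isClosed_Icc isClosed_Iic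
  have hSne : S.Nonempty := ⟨a, ⟨le_refl _, hab⟩, ha.le⟩
  have hSb : BddAbove S := ⟨b, fun t ht => ht.1.2⟩
  set t := sSup S with ht
  have htS : t ∈ S := hSc.csSup_mem hSne hSb
  have htb : t < b := lt_of_le_of_ne htS.1.2 fun h => by
    have := htS.2; rw [h] at this; linarith
  have hafter : ∀ s ∈ Ioc t b, y < f s := fun s hs => by
    by_contra! h
    exact absurd (le_csSup hSb ⟨⟨htS.1.1.trans hs.1.le, hs.2⟩, h⟩) (not_le.2 hs.1)
  have hft : f t = y := by
    refine le_antisymm htS.2 ?_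
    have hc : Tendsto f (𝓝[Ioc t b] t) (𝓝 (f t)) :=
      (hf t htS.1).mono_left (nhdsWithin_mono _ fun s hs => ⟨htS.1.1.trans hs.1.le, hs.2⟩)
    have : (𝓝[Ioc t b] t).NeBot := by
      rw [nhdsWithin_Ioc_eq_nhdsGT htb]; infer_instance
    exact ge_of_tendsto hc (eventually_mem_nhdsWithin.mono fun s hs => (hafter s hs).le)
  refine ⟨t, ⟨lt_of_le_of_ne htS.1.1 fun h => ?_, htb⟩, hft, hafter⟩
  rw [← h] at hft; linarith

/-- A function that is decreasing whenever its value lies in the band `(c₁, c₂)` cannot cross this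
band upwards. The derivative may fail to exist on a countable set. -/
lemma lt_of_hasDerivAt_neg_in_band {f f' : ℝ → ℝ} {a b c₁ c₂ : ℝ} {E : Set ℝ} (hab : a ≤ b)
    (hf : ContinuousOn f (Icc a b)) (hE : E.Countable) (hc : c₁ < c₂) (ha : f a < c₂)
    (hd : ∀ t ∈ Ioo a b \ E, f t ∈ Ioo c₁ c₂ → HasDerivAt f (f' t) t ∧ f' t < 0) :
    f b < c₂ := by
  by_contra! hb
  have hlt : max (f a) c₁ < c₂ := max_lt ha hc
  -- The image of `E` is countable, hence null, so some level in the band is not attained on `E`.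
  -- The derivative then exists at the last crossing of that level, and it must be nonnegative
  -- there.
  obtain ⟨y, hy, hyE⟩ : (Ioo (max (f a) c₁) c₂ \ f '' E).Nonempty := by
    by_contra! h
    have hsub : Ioo (max (f a) c₁) c₂ ⊆ f '' E := sdiff_eq_empty.1 h
    have hvol := MeasureTheory.measure_mono (μ := MeasureTheory.volume) hsub
    rw [(hE.image f).measure_zero, Real.volume_Ioo] at hvol
    simp at hvol
    rcases hvol with h | h <;> linarith
  obtain ⟨t, ht, hft, hafter⟩ := exists_last_crossing hab hf
    ((le_max_left _ _).trans_lt hy.1) (hy.2.trans_le hb)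
  have htE : t ∉ E := fun h => hyE ⟨t, h, hft⟩
  obtain ⟨hder, hneg⟩ := hd t ⟨ht, htE⟩
    ⟨hft ▸ (le_max_right _ _).trans_lt hy.1, hft ▸ hy.2⟩
  have hslope := (hasDerivAt_iff_tendsto_slope.1 hder).mono_left
    (nhdsWithin_mono t (fun s (hs : s ∈ Ioi t) => ne_of_gt hs))
  have : 0 ≤ f' t := by
    refine ge_of_tendsto hslope ?_
    filter_upwards [Ioc_mem_nhdsGT ht.2] with s hs
    rw [slope_def_field]
    exact div_nonneg (by rw [hft]; linarith [hafter s hs]) (by linarith [hs.1])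
  linarith

/-- A continuous function with nonpositive derivative off a countable set does not increase. -/
lemma le_of_hasDerivAt_nonpos {f f' : ℝ → ℝ} {a b : ℝ} {E : Set ℝ} (hab : a ≤ b)
    (hf : ContinuousOn f (Icc a b)) (hE : E.Countable)
    (hd : ∀ t ∈ Ioo a b \ E, HasDerivAt f (f' t) t ∧ f' t ≤ 0) : f b ≤ f a := by
  refine le_of_forall_pos_lt_add fun δ hδ => ?_
  -- Tilting by slope `-η` makes the derivative strictly negative, so that the band lemma applies;
  -- the total tilt over `[a, b]` is at most `δ / 2`.
  set η : ℝ := δ / (2 * (b - a + 1)) with hη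
  have hba : 0 < b - a + 1 := by linarith
  have hη0 : 0 < η := by positivity
  have key : f b - η * (b - a) < f a + δ / 2 := by
    refine lt_of_hasDerivAt_neg_in_band (f := fun t => f t - η * (t - a)) (f' := fun t => f' t - η)
      (c₁ := f a) hab (hf.sub (by fun_prop)) hE (by linarith) (by simp; linarith) ?_
    intro t ht _
    obtain ⟨h1, h2⟩ := hd t ht
    refine ⟨?_, by linarith⟩
    simpa using h1.fun_sub (((hasDerivAt_id t).sub_const a).const_mul η)
  have : η * (b - a) ≤ δ / 2 := by
    have : η * (b - a + 1) = δ / 2 := by rw [hη]; field_simp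
    nlinarith
  linarith

/-- Grönwall estimate for a stable scalar differential inequality. -/
lemma le_exp_mul_add_of_hasDerivAt {U U' : ℝ → ℝ} {a b α c : ℝ} {E : Set ℝ} (hab : a ≤ b)
    (hU : ContinuousOn U (Icc a b)) (hE : E.Countable) (hα : 0 < α) (hc : 0 ≤ c)
    (hd : ∀ t ∈ Ioo a b \ E, HasDerivAt U (U' t) t ∧ U' t ≤ -α * U t + c) :
    U b ≤ Real.exp (-α * (b - a)) * U a + c / α := by
  have key : Real.exp (α * (b - a)) * (U b - c / α) ≤ Real.exp (α * (a - a)) * (U a - c / α) := by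
    refine le_of_hasDerivAt_nonpos (f := fun t => Real.exp (α * (t - a)) * (U t - c / α))
      (f' := fun t => Real.exp (α * (t - a)) * (α * (U t - c / α) + U' t)) hab
      (ContinuousOn.mul (by fun_prop) (hU.sub continuousOn_const)) hE ?_
    intro t ht
    obtain ⟨h1, h2⟩ := hd t ht
    refine ⟨?_, mul_nonpos_of_nonneg_of_nonpos (Real.exp_pos _).le ?_⟩
    · have he : HasDerivAt (fun s => Real.exp (α * (s - a))) (Real.exp (α * (t - a)) * α) t := by
        simpa using (((hasDerivAt_id t).sub_const a).const_mul α).exp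
      exact (he.fun_mul (h1.sub_const (c / α))).congr_deriv (by ring)
    · have : α * (c / α) = c := by field_simp
      linarith
  rw [sub_self, mul_zero, Real.exp_zero, one_mul] at key
  have h3 := mul_le_mul_of_nonneg_left key (Real.exp_pos (-α * (b - a))).le
  rw [← mul_assoc, ← Real.exp_add, show -α * (b - a) + α * (b - a) = 0 by ring, Real.exp_zero,
    one_mul, mul_sub] at h3
  have : 0 ≤ Real.exp (-α * (b - a)) * (c / α) := by positivity
  linarith

/-- Barbalat-type lemma: the dissipation rate `φ` of a function bounded from below tends to zero
if `φ` cannot fall faster than linearly. -/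
lemma tendsto_zero_of_dissipation {V V' φ φ' : ℝ → ℝ} {a L : ℝ} {E : Set ℝ} (hE : E.Countable)
    (hV : ContinuousOn V (Ici a)) (hφ : ContinuousOn φ (Ici a)) (hV0 : ∀ t ∈ Ici a, 0 ≤ V t)
    (hφ0 : ∀ t ∈ Ici a, 0 ≤ φ t)
    (hdV : ∀ t ∈ Ici a \ E, HasDerivAt V (V' t) t ∧ V' t ≤ -φ t)
    (hdφ : ∀ t ∈ Ici a \ E, HasDerivAt φ (φ' t) t ∧ -L ≤ φ' t) :
    Tendsto φ atTop (𝓝 0) := by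
  wlog hL : 0 < L generalizing L
  · refine this (L := 1) (fun t ht => ⟨(hdφ t ht).1, ?_⟩) one_pos
    have := (hdφ t ht).2
    linarith
  have sub : ∀ {s t}, a ≤ s → Icc s t ⊆ Ici a := fun h x hx => h.trans hx.1
  have mono : ∀ s t, a ≤ s → s ≤ t → V t ≤ V s := fun s t hs hst =>
    le_of_hasDerivAt_nonpos hst (hV.mono (sub hs)) hE fun x hx =>
      have hx' : x ∈ Ici a := hs.trans hx.1.1.le
      ⟨(hdV x ⟨hx', hx.2⟩).1, by linarith [(hdV x ⟨hx', hx.2⟩).2, hφ0 x hx']⟩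
  set I := sInf (V '' Ici a) with hI
  have hIb : BddBelow (V '' Ici a) := ⟨0, by rintro _ ⟨t, ht, rfl⟩; exact hV0 t ht⟩
  have hIne : (V '' Ici a).Nonempty := ⟨V a, a, self_mem_Ici, rfl⟩
  rw [Metric.tendsto_atTop]
  intro ε hε
  -- If `φ ≥ ε` at some time, `φ` stays above `ε / 2` for a duration `h`. That costs `V` at least `ε
  -- / 2 * h`, more than the distance to its infimum once time is past `N`.
  set h := ε / (2 * L) with hh
  have hh0 : 0 < h := by positivity
  obtain ⟨_, ⟨N, hN, rfl⟩, hNlt⟩ := exists_lt_of_csInf_lt hIne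
    (show sInf (V '' Ici a) < I + ε / 2 * h by rw [← hI]; linarith [mul_pos (half_pos hε) hh0])
  refine ⟨N, fun t ht => ?_⟩
  have hat : a ≤ t := le_trans hN ht
  rw [Real.dist_eq, sub_zero, abs_of_nonneg (hφ0 t hat)]
  by_contra! hge
  have hlow : ∀ s ∈ Icc t (t + h), ε / 2 ≤ φ s := fun s hs => by
    have := le_of_hasDerivAt_nonpos (f := fun x => -φ x - L * x) (f' := fun x => -φ' x - L) hs.1
      (((hφ.mono (sub hat)).neg).sub (by fun_prop)) hE fun x hx => by
        have hx' : x ∈ Ici a := hat.trans hx.1.1.le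
        obtain ⟨h1, h2⟩ := hdφ x ⟨hx', hx.2⟩
        exact ⟨by simpa using h1.fun_neg.fun_sub ((hasDerivAt_id x).const_mul L), by linarith⟩
    have h2 : L * h = ε / 2 := by rw [hh]; field_simp
    have h3 : L * (s - t) ≤ L * h := mul_le_mul_of_nonneg_left (by linarith [hs.2]) hL.le
    linarith
  have hdec := le_of_hasDerivAt_nonpos (f := fun x => V x + ε / 2 * x)
    (f' := fun x => V' x + ε / 2) (show t ≤ t + h by linarith)
    ((hV.mono (sub hat)).add (by fun_prop)) hE fun x hx => by
      have hx' : x ∈ Ici a := hat.trans hx.1.1.le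
      obtain ⟨h1, h2⟩ := hdV x ⟨hx', hx.2⟩
      refine ⟨by simpa using h1.fun_add ((hasDerivAt_id x).const_mul (ε / 2)), ?_⟩
      linarith [hlow x ⟨hx.1.1.le, hx.1.2.le⟩]
  have h1 : I ≤ V (t + h) := csInf_le hIb ⟨t + h, by simp only [mem_Ici]; linarith, rfl⟩
  have h2 := mono N t hN ht
  linarith

end Calculus

/-! ### Geometry of a saturated, perturbed feedback -/

section Geometry

variable {E : Type*} [NormedAddCommGroup E] [InnerProductSpace ℝ E]

local notation "⟪" x ", " y "⟫" => inner ℝ x y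

/-- If `w` is nearly the longest vector of length `k` in the direction `n`, a perturbation `h` that
is shorter by a fixed factor leaves `w + h` within a fixed cone around `n`. -/
lemma norm_add_lt_four_mul_inner {n w h : E} {k d G : ℝ} (hn : ‖n‖ = 1) (hk : 0 < k) (hd : 0 ≤ d)
    (hw : ‖w‖ ≤ k) (hh : ‖h‖ ≤ G) (hG : G < √2 / 3 * (2 * k - 5 * d))
    (ha : k - d / 2 ≤ ⟪n, w⟫) : ‖w + h‖ < 4 * ⟪n, w + h⟫ := by
  have hs2 : √2 < 1.4143 := by
    rw [Real.sqrt_lt' (by norm_num)]; norm_num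
  have hs2' : 1.4142 < √2 := by
    rw [Real.lt_sqrt (by norm_num)]; norm_num
  set a := ⟪n, w⟫ with ha'
  set v := ⟪n, w + h⟫ with hv'
  have hG0 : 0 ≤ G := (norm_nonneg _).trans hh
  have h25 : 0 < 2 * k - 5 * d := by
    by_contra! hc
    have := mul_nonpos_of_nonneg_of_nonpos (show 0 ≤ √2 / 3 by positivity) hc
    linarith
  -- Rational form of `hG` multiplied by `25`, the length of the test vector `f` below.
  have hG2 : 25 * G < 23.575 * k - 58 * d := by nlinarith
  have hva : v = a + ⟪n, h⟫ := inner_add_right _ _ _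
  have hnh : |⟪n, h⟫| ≤ G := (abs_real_inner_le_norm n h).trans (by rw [hn, one_mul]; exact hh)
  have hv0 : 0 < v := by
    have := (abs_le.1 hnh).1
    rw [hva]; linarith
  set p := (w + h) - v • n with hp
  have hnn : ⟪n, n⟫ = 1 := by rw [real_inner_self_eq_norm_sq, hn]; norm_num
  have hnp : ⟪n, p⟫ = 0 := by
    rw [hp, inner_sub_right, inner_smul_right, hnn, ← hv']; ring
  have hz2 : ‖w + h‖ ^ 2 = v ^ 2 + ‖p‖ ^ 2 := by
    have : w + h = v • n + p := by rw [hp]; abel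
    rw [this, norm_add_sq_real, inner_smul_left, hnp, norm_smul, hn]
    simp
  -- By the triple `7, 24, 25` this gives `‖w + h‖ ≤ (25/7) v`, and `25/7 < 4`.
  have hmain : 7 * ‖p‖ ≤ 24 * v := by
    rcases (norm_nonneg p).eq_or_lt with h0 | h0
    · rw [← h0]; linarith
    -- The normal to the boundary of the cone, of length `25`. The claim is that `f` pairs
    -- nonnegatively with `w + h`; the perturbation `h` contributes at least `-25 G`.
    set f := (24 : ℝ) • n - (7 / ‖p‖) • p with hf
    have hfn : ‖f‖ ^ 2 = 25 ^ 2 := by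
      rw [hf, norm_sub_sq_real, inner_smul_left, inner_smul_right, hnp, norm_smul, norm_smul, hn]
      simp
      field_simp
      norm_num
    have hf25 : ‖f‖ = 25 := by
      have := norm_nonneg f
      nlinarith
    have hfz : ⟪f, w + h⟫ = 24 * v - 7 * ‖p‖ := by
      have hpz : ⟪p, w + h⟫ = ‖p‖ ^ 2 := by
        have : w + h = v • n + p := by rw [hp]; abel
        rw [this, inner_add_right, inner_smul_right, real_inner_comm, hnp,
          real_inner_self_eq_norm_sq]
        ring
      rw [hf, inner_sub_left, inner_smul_left, inner_smul_left, hpz, ← hv']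
      simp
      field_simp
    have hfh : -(25 * G) ≤ ⟪f, h⟫ := by
      have h1 := (abs_le.1 (abs_real_inner_le_norm f h)).1
      rw [hf25] at h1
      linarith
    -- The part of `w` orthogonal to `n` has square at most `k² - (k - d/2)² ≤ k d`.
    have hpw : ⟪p, w⟫ ≤ ‖p‖ * √(k * d) := by
      have e1 : ⟪p, w⟫ = ⟪p, w - a • n⟫ := by
        rw [inner_sub_right, inner_smul_right, real_inner_comm n p, hnp, mul_zero, sub_zero]
      have e2 : ‖w - a • n‖ ≤ √(k * d) := by
        apply Real.le_sqrt_of_sq_le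
        rw [norm_sub_sq_real, inner_smul_right, norm_smul, hn, real_inner_comm, ← ha', mul_one,
          Real.norm_eq_abs, sq_abs]
        have hwk : ‖w‖ ^ 2 ≤ k ^ 2 := pow_le_pow_left₀ (norm_nonneg _) hw 2
        nlinarith
      rw [e1]
      exact (real_inner_le_norm _ _).trans (mul_le_mul_of_nonneg_left e2 (norm_nonneg _))
    have hfw : 24 * a - 7 * √(k * d) ≤ ⟪f, w⟫ := by
      rw [hf, inner_sub_left, inner_smul_left, inner_smul_left, ← ha']
      simp only [conj_trivial]
      have : 7 / ‖p‖ * ⟪p, w⟫ ≤ 7 / ‖p‖ * (‖p‖ * √(k * d)) :=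
        mul_le_mul_of_nonneg_left hpw (by positivity)
      have e : 7 / ‖p‖ * (‖p‖ * √(k * d)) = 7 * √(k * d) := by field_simp
      linarith
    -- The weights are admissible because `4 · 0.4 · 31 > 49`, and they fit the slack between `24 a`
    -- and `25 G`.
    have hamgm : 7 * √(k * d) ≤ 0.4 * k + 31 * d := by
      have := Real.sq_sqrt (mul_nonneg hk.le hd)
      have h1 := Real.sqrt_nonneg (k * d)
      refine abs_le_of_sq_le_sq' ?_ (by positivity) |>.2
      nlinarith [sq_nonneg (0.4 * k - 31 * d), mul_nonneg hk.le hd]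
    have := inner_add_right (𝕜 := ℝ) f w h
    linarith
  have : ‖w + h‖ ^ 2 < (4 * v) ^ 2 := by
    rw [hz2]
    have hp0 := norm_nonneg p
    nlinarith
  exact lt_of_pow_lt_pow_left₀ 2 (by positivity) this

/-- The saturated push along `n` beats the destabilising term, for unit `n`. -/
lemma inner_sub_scaled_lt {n w h : E} {k G d uMax s : ℝ} (hn : ‖n‖ = 1) (hk : 0 < k) (hd : 0 ≤ d)
    (hw : ‖w‖ ≤ k) (hh : ‖h‖ ≤ G) (hG : G < √2 / 3 * (2 * k - 5 * d)) (hu : 2 * d ≤ uMax)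
    (hu0 : 0 < uMax) (hs1 : s ≤ 1) (hs : s * ‖w + h‖ = uMax) :
    ⟪n, w⟫ - s * ⟪n, w + h⟫ < k - d / 2 := by
  have hs2 : √2 < 1.5 := by
    rw [Real.sqrt_lt' (by norm_num)]; norm_num
  have hs0 : 0 < s := by
    by_contra! hc
    have := mul_nonpos_of_nonpos_of_nonneg hc (norm_nonneg (w + h))
    linarith
  -- Below this threshold the push is either helpful or, having factor `s ≤ 1`, harmful by at most
  -- what `h` allows. Above it the cone lemma makes the push exceed `uMax / 4 ≥ d / 2`.
  rcases lt_or_ge ⟪n, w⟫ (k - d / 2) with h1 | h1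
  · rcases le_or_gt ⟪n, w + h⟫ 0 with h2 | h2
    · have e := inner_add_right (𝕜 := ℝ) n w h
      have hnh := (abs_le.1 (abs_real_inner_le_norm n h)).1
      rw [hn] at hnh
      have h25 : 0 < 2 * k - 5 * d := by
        by_contra! hc
        have := mul_nonpos_of_nonneg_of_nonpos (show 0 ≤ √2 / 3 by positivity) hc
        linarith [norm_nonneg h]
      nlinarith
    · nlinarith
  · have h2 := norm_add_lt_four_mul_inner hn hk hd hw hh hG h1
    have h3 : ⟪n, w⟫ ≤ k := (real_inner_le_norm n w).trans (by rw [hn, one_mul]; exact hw)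
    have h4 := mul_lt_mul_of_pos_left h2 hs0
    linarith

/-- Decrease of the quadratic form under a saturated feedback `y + g` when `y` is the ideal
feedback. Here `n` is the gradient direction, `X` the length of the state. -/
lemma saturated_decrease {n y g : E} {q p X k G K uMax s : ℝ} (hp : 0 < p) (hX : 0 < X)
    (hk : 0 ≤ k) (hK : 0 < K) (hKG : K ≤ G) (hu : 0 < uMax) (hD : q - 2 * p * k ≠ 0)
    (hn : ‖n‖ ≤ p * X) (hy : ‖y‖ ≤ k * X) (hg : ‖g‖ ≤ G * X)
    (hG : p * G < √2 / 3 * (q - 2 * (|q - 2 * p * k| * (k + K) / K)))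
    (hXm : X * |q - 2 * p * k| ≤ p * (uMax * K / (k + K)))
    (hs0 : 0 < s) (hs : s = 1 ∨ s ≤ 1 ∧ s * ‖y + g‖ = uMax) :
    -(q * X ^ 2) + 2 * (⟪n, s • (y + g)⟫ - ⟪n, y⟫) < 0 := by
  have hs2 : √2 < 1.5 := by
    rw [Real.sqrt_lt' (by norm_num)]; norm_num
  have hDpos : 0 < |q - 2 * p * k| := abs_pos.2 hD
  have hr : 0 ≤ |q - 2 * p * k| * (k + K) / K := by positivity
  have hpG : 0 < p * G := mul_pos hp (hK.trans_le hKG)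
  have hpos : 0 < q - 2 * (|q - 2 * p * k| * (k + K) / K) := by
    by_contra! hc
    have := mul_nonpos_of_nonneg_of_nonpos (show 0 ≤ √2 / 3 by positivity) hc
    linarith
  have hq : 0 < q := by linarith
  have hGq : 2 * (p * G) < q := by
    have : √2 / 3 * (q - 2 * (|q - 2 * p * k| * (k + K) / K)) ≤ √2 / 3 * q :=
      mul_le_mul_of_nonneg_left (by linarith) (by positivity)
    nlinarith
  rcases (norm_nonneg n).eq_or_lt with hn0 | hn0
  · have : n = 0 := norm_eq_zero.1 hn0.symm
    subst this
    simp only [inner_zero_left]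
    nlinarith [mul_pos hq (pow_pos hX 2)]
  set m := ‖n‖⁻¹ • n with hm
  have hm1 : ‖m‖ = 1 := by
    rw [hm, norm_smul, norm_inv, norm_norm, inv_mul_cancel₀ hn0.ne']
  have hmy : |⟪m, y⟫| ≤ k * X := (abs_real_inner_le_norm m y).trans (by rw [hm1, one_mul]; exact hy)
  have hmg : |⟪m, g⟫| ≤ G * X := (abs_real_inner_le_norm m g).trans (by rw [hm1, one_mul]; exact hg)
  have hadd := inner_add_right (𝕜 := ℝ) m y g
  -- After normalizing the gradient, this is the whole claim: multiplying by `‖n‖ ≤ p * X` recovers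
  -- it when the bracket is positive, and a nonpositive bracket is trivial.
  have key : 2 * p * (s * ⟪m, y + g⟫ - ⟪m, y⟫) < q * X := by
    have hgX : 2 * p * ⟪m, g⟫ < q * X := by
      have h1 := mul_lt_mul_of_pos_right hGq hX
      have h2 := mul_le_mul_of_nonneg_left (abs_le.1 hmg).2 (show 0 ≤ 2 * p by positivity)
      linarith
    rcases hs with rfl | ⟨hs1, hsu⟩
    · rw [hadd]; linarith
    rcases lt_or_gt_of_ne hD with hneg | hposD
    · have habs : |q - 2 * p * k| = 2 * p * k - q := by rw [abs_of_neg hneg]; ring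
      rw [habs] at hG hXm hr hDpos hpos
      -- `d * X` is the deficit of the uncontrolled form, chosen so that `2 * p * (k * X - d * X /
      -- 2) = q * X`.
      set d := (2 * p * k - q) / p with hd
      have hdp : p * d = 2 * p * k - q := by rw [hd]; field_simp
      have hd0 : 0 < d := div_pos hDpos hp
      have hk0 : 0 < k := by
        rcases hk.eq_or_lt with h0 | h0
        · rw [← h0] at hneg; linarith
        · exact h0
      have hKk : K < k := by
        have : p * K ≤ p * G := mul_le_mul_of_nonneg_left hKG hp.le
        have : p * K < p * k := by linarith
        exact lt_of_mul_lt_mul_left this hp.le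
      -- Since `K < k`, the ratio `(k + K) / K` is at least `2`. This turns the margin `hG` into the
      -- bound on `G` required by the geometric lemma. The same inequality bounds `a₀` by `uMax /
      -- 2`.
      have ht : 2 * (2 * p * k - q) ≤ (2 * p * k - q) * (k + K) / K := by
        rw [le_div_iff₀ hK]
        nlinarith
      have hG' : G < √2 / 3 * (2 * k - 5 * d) := by
        have h1 : p * G < √2 / 3 * (q - 4 * (2 * p * k - q)) := by
          refine hG.trans_le (mul_le_mul_of_nonneg_left ?_ (by positivity))
          linarith
        have h2 : p * (√2 / 3 * (2 * k - 5 * d)) = √2 / 3 * (q - 4 * (2 * p * k - q)) := by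
          linear_combination (√2 / 3) * (-5) * hdp
        rw [← h2] at h1
        exact lt_of_mul_lt_mul_left h1 hp.le
      have hud : 2 * (d * X) ≤ uMax := by
        have h1 : p * (d * X) ≤ p * (uMax * K / (k + K)) := by
          calc p * (d * X) = X * (2 * p * k - q) := by rw [← mul_assoc, hdp]; ring
            _ ≤ _ := hXm
        have h2 := le_of_mul_le_mul_left h1 hp
        have h3 : uMax * K / (k + K) ≤ uMax / 2 := by
          rw [div_le_div_iff₀ (by positivity) (by norm_num)]
          nlinarith
        linarith
      have := inner_sub_scaled_lt (w := -y) (h := -g) (n := m) (k := k * X) (G := G * X)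
        (d := d * X) (s := s) hm1 (by positivity) (by positivity) (by rwa [norm_neg])
        (by rwa [norm_neg])
        (by
          have := mul_lt_mul_of_pos_right hG' hX
          calc G * X < _ := this
            _ = _ := by ring)
        hud hu hs1 (by rw [← neg_add, norm_neg]; exact hsu)
      rw [← neg_add, inner_neg_right, inner_neg_right] at this
      have h5 := mul_lt_mul_of_pos_left this (show 0 < 2 * p by positivity)
      have h6 : 2 * p * (k * X - d * X / 2) = q * X := by
        linear_combination (-X) * hdp
      linarith
    · have h1 : -⟪m, y⟫ ≤ k * X := by linarith [(abs_le.1 hmy).1]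
      have h2 : 2 * p * (-⟪m, y⟫) < q * X := by
        have h3 := mul_le_mul_of_nonneg_left h1 (show 0 ≤ 2 * p by positivity)
        have h4 : 2 * p * (k * X) < q * X := by nlinarith
        linarith
      -- Convex combination of full input and zero input; each of the two terms is below `q * X`.
      have e : 2 * p * (s * ⟪m, y + g⟫ - ⟪m, y⟫)
          = s * (2 * p * ⟪m, g⟫) + (1 - s) * (2 * p * (-⟪m, y⟫)) := by rw [hadd]; ring
      rw [e]
      have h3 := mul_lt_mul_of_pos_left hgX hs0
      have h4 := mul_le_mul_of_nonneg_left h2.le (show 0 ≤ 1 - s by linarith)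
      linarith
  have e : ⟪n, s • (y + g)⟫ - ⟪n, y⟫ = ‖n‖ * (s * ⟪m, y + g⟫ - ⟪m, y⟫) := by
    have e1 : ∀ x, ⟪n, x⟫ = ‖n‖ * ⟪m, x⟫ := fun x => by
      rw [hm, inner_smul_left, conj_trivial, mul_inv_cancel_left₀ hn0.ne']
    rw [e1, e1, inner_smul_right]
    ring
  rw [e]
  set c := s * ⟪m, y + g⟫ - ⟪m, y⟫
  rcases le_or_gt c 0 with hc | hc
  · have := mul_nonpos_of_nonneg_of_nonpos hn0.le hc
    nlinarith [mul_pos hq (pow_pos hX 2)]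
  · have h1 := mul_le_mul_of_nonneg_right hn hc.le
    have h2 := mul_lt_mul_of_pos_right key hX
    linarith

end Geometry

/-! ### Derivatives of quadratic forms -/

section MatrixCalculus

variable {ι κ : Type*} [Fintype ι] [Fintype κ]

lemma HasDerivAt.dotProduct {x y : ℝ → ι → ℝ} {x' y' : ι → ℝ} {t : ℝ} (hx : HasDerivAt x x' t)
    (hy : HasDerivAt y y' t) :
    HasDerivAt (fun s => x s ⬝ᵥ y s) (x' ⬝ᵥ y t + x t ⬝ᵥ y') t := by
  have h := HasDerivAt.fun_sum (u := Finset.univ)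
    fun i _ => (hasDerivAt_pi.1 hx i).fun_mul (hasDerivAt_pi.1 hy i)
  rw [Finset.sum_add_distrib] at h
  exact h

omit [Fintype ι] in
lemma HasDerivAt.const_mulVec {x : ℝ → κ → ℝ} {x' : κ → ℝ} {t : ℝ} (hx : HasDerivAt x x' t)
    (A : Matrix ι κ ℝ) : HasDerivAt (fun s => A *ᵥ x s) (A *ᵥ x') t := by
  refine hasDerivAt_pi.2 fun i => ?_
  exact ((hasDerivAt_const t (A i)).dotProduct hx).congr_deriv (by simp [mulVec])

lemma HasDerivAt.quadForm {P : Matrix ι ι ℝ} (hP : Pᵀ = P) {x : ℝ → ι → ℝ} {x' : ι → ℝ} {t : ℝ}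
    (hx : HasDerivAt x x' t) :
    HasDerivAt (fun s => x s ⬝ᵥ P *ᵥ x s) (2 * (P *ᵥ x t ⬝ᵥ x')) t := by
  refine (hx.dotProduct (hx.const_mulVec P)).congr_deriv ?_
  rw [dotProduct_mulVec_eq P (x t) x', hP, dotProduct_comm x']
  ring

lemma ContinuousOn.quadForm {s : Set ℝ} {x : ℝ → ι → ℝ} (hx : ContinuousOn x s)
    (P : Matrix ι ι ℝ) : ContinuousOn (fun t => x t ⬝ᵥ P *ᵥ x t) s := by
  have : Continuous fun v : ι → ℝ => v ⬝ᵥ P *ᵥ v := by fun_prop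
  exact this.comp_continuousOn hx

/-- Lyapunov identity for a stable linear system. -/
lemma two_mul_lyapunov {A P Q : Matrix ι ι ℝ} (hP : Pᵀ = P) (h : Aᵀ * P + P * A = -Q) (x : ι → ℝ) :
    2 * (P *ᵥ x ⬝ᵥ A *ᵥ x) = -(x ⬝ᵥ Q *ᵥ x) := by
  have h1 : x ⬝ᵥ (P * A) *ᵥ x = P *ᵥ x ⬝ᵥ A *ᵥ x := by
    rw [← mulVec_mulVec, dotProduct_mulVec_eq, hP]
  have h2 : x ⬝ᵥ (Aᵀ * P) *ᵥ x = P *ᵥ x ⬝ᵥ A *ᵥ x := by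
    rw [← mulVec_mulVec, dotProduct_mulVec_eq, transpose_transpose, dotProduct_comm]
  have h3 : x ⬝ᵥ (Aᵀ * P + P * A) *ᵥ x = x ⬝ᵥ (-Q) *ᵥ x := by rw [h]
  rw [add_mulVec, dotProduct_add, h1, h2, neg_mulVec, dotProduct_neg] at h3
  linarith

lemma diagonal_mulVec_eq_mul [DecidableEq ι] (d v : ι → ℝ) : diagonal d *ᵥ v = d * v := by
  ext i; simp [mulVec_diagonal]

end MatrixCalculus

/-! ### Error equation and exact derivative of the Lyapunov function -/

namespace MSACSystem

variable {nx nu : ℕ} {S : MSACSystem nx nu} {z : MSACSignals nx nu} {t : ℝ}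

lemma Standing.P_transpose (hS : S.Standing) : S.Pᵀ = S.P := by
  simpa using hS.P_posDef.isHermitian.eq

lemma weightedTrace_eq (M : Matrix (Fin nu) (Fin nx ⊕ Fin nu) ℝ) (v : Fin nu → ℝ) :
    S.weightedTrace M v = ∑ i, (S.lam i * (M i ⬝ᵥ M i) + v i ^ 2) := by
  have h1 : (Mᵀ * diagonal S.lam * M).trace = ∑ i, S.lam i * (M i ⬝ᵥ M i) := by
    simp only [trace, diag, mul_apply (M := Mᵀ * diagonal S.lam), mul_diagonal, transpose_apply,
      dotProduct, Finset.mul_sum]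
    rw [Finset.sum_comm]
    exact Finset.sum_congr rfl fun i _ => Finset.sum_congr rfl fun j _ => by ring
  simp only [weightedTrace, LamA, Lam, fromBlocks_transpose, fromBlocks_multiply]
  rw [Finset.sum_add_distrib, ← h1]
  simp [trace, Fintype.sum_sum_type, sq]

lemma hasDerivAt_weightedTrace {M : ℝ → Matrix (Fin nu) (Fin nx ⊕ Fin nu) ℝ} {v : ℝ → Fin nu → ℝ}
    {M' : Matrix (Fin nu) (Fin nx ⊕ Fin nu) ℝ} {v' : Fin nu → ℝ}
    (hM : ∀ i j, HasDerivAt (fun s => M s i j) (M' i j) t)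
    (hv : ∀ i, HasDerivAt (fun s => v s i) (v' i) t) :
    HasDerivAt (fun s => S.weightedTrace (M s) (v s))
      (∑ i, (S.lam i * (2 * (M t i ⬝ᵥ M' i)) + 2 * v t i * v' i)) t := by
  simp only [weightedTrace_eq]
  refine HasDerivAt.fun_sum fun i _ => ?_
  have h : HasDerivAt (fun s => M s i) (M' i) t := hasDerivAt_pi.2 (hM i)
  refine (((h.dotProduct h).const_mul (S.lam i)).fun_add ((hv i).fun_pow 2)).congr_deriv ?_
  rw [dotProduct_comm (M' i)]
  push_cast
  ring

lemma u_add_deltaU (z : MSACSignals nx nu) (t : ℝ) :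
    ballSat S.uMax (u z t) = u z t + S.deltaU z t := by
  simp [deltaU]

lemma Theta_mulVec_Phi (z : MSACSignals nx nu) (t : ℝ) :
    S.Theta *ᵥ Phi z t = S.Kx *ᵥ z.xp t + S.Kr *ᵥ z.r t := by
  simp [Theta, Phi, fromCols_mulVec]

/-- The plant in terms of the reference dynamics. -/
lemma LoopAt.plant' (hS : S.Standing) (h : S.LoopAt z t) :
    HasDerivAt z.xp (S.Am *ᵥ z.xp t
      + (S.Bp * S.Lam) *ᵥ (ballSat S.uMax (u z t) - S.Kx *ᵥ z.xp t)) t := by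
  refine h.plant.congr_deriv ?_
  rw [← hS.match_x, add_mulVec, mulVec_sub, ← mulVec_mulVec (z.xp t) (S.Bp * S.Lam)]
  abel

/-- Mismatch `Λ Θ̃ Φ - diag(λ̃) Δu` that drives the augmented error. -/
def mismatch (S : MSACSystem nx nu) (z : MSACSignals nx nu) (t : ℝ) : Fin nu → ℝ :=
  S.lam * ((z.ThetaHat t - S.Theta) *ᵥ Phi z t) - (z.lamHat t - S.lam) * S.deltaU z t

/-- The matching conditions cancel the reference input, and `e_Δ` takes away the term `diag(λ̂) Δu`.
What remains is linear in the parameter errors, with regressors `Φ` and `Δu`. -/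
lemma LoopAt.hasDerivAt_errU (hS : S.Standing) (h : S.LoopAt z t) :
    HasDerivAt (errU z) (S.Am *ᵥ errU z t + S.Bp *ᵥ S.mismatch z t) t := by
  refine (((h.plant' hS).sub h.reference).sub h.auxiliary).congr_deriv ?_
  have h2 : ballSat S.uMax (u z t) - S.Kx *ᵥ z.xp t
      = (z.ThetaHat t - S.Theta) *ᵥ Phi z t + S.Kr *ᵥ z.r t + S.deltaU z t := by
    rw [u_add_deltaU, sub_mulVec, Theta_mulVec_Phi, u]; abel
  have h3 : S.mismatch z t = S.Lam *ᵥ ((z.ThetaHat t - S.Theta) *ᵥ Phi z t) +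
      S.Lam *ᵥ S.deltaU z t - diagonal (z.lamHat t) *ᵥ S.deltaU z t := by
    simp only [mismatch, Lam, diagonal_mulVec_eq_mul]; ring
  rw [h2, h3, ← hS.match_r, errU, err]
  simp only [← mulVec_mulVec, mulVec_sub, mulVec_add]
  abel

/-- `B_pᵀ P e_u` -/
def drive (S : MSACSystem nx nu) (z : MSACSignals nx nu) (t : ℝ) : Fin nu → ℝ :=
  (S.Bpᵀ * S.P) *ᵥ errU z t

lemma dotProduct_input (S : MSACSystem nx nu) (x : Fin nx → ℝ) (g : Fin nu → ℝ) :
    S.P *ᵥ x ⬝ᵥ S.Bp *ᵥ g = (S.Bpᵀ * S.P) *ᵥ x ⬝ᵥ g := by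
  rw [dotProduct_mulVec_eq, mulVec_mulVec]

lemma LoopAt.hasDerivAt_errU_quadForm (hS : S.Standing) (h : S.LoopAt z t) :
    HasDerivAt (fun s => errU z s ⬝ᵥ S.P *ᵥ errU z s)
      (-(errU z t ⬝ᵥ S.Q *ᵥ errU z t) + 2 * (S.drive z t ⬝ᵥ S.mismatch z t)) t := by
  refine ((h.hasDerivAt_errU hS).quadForm hS.P_transpose).congr_deriv ?_
  rw [dotProduct_add, mul_add, two_mul_lyapunov hS.P_transpose hS.lyapunov,
    dotProduct_input, drive]

/-- Exact derivative of the Lyapunov function. -/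
lemma LoopAt.hasDerivAt_V (hS : S.Standing) (h : S.LoopAt z t) :
    HasDerivAt (S.V z) (-(errU z t ⬝ᵥ S.Q *ᵥ errU z t)
      + 4 * (S.drive z t ⬝ᵥ (S.lam * ((z.ThetaHat t - z.Xi t) *ᵥ Phi z t)
        - (z.lamHat t - z.lamEps t) * S.deltaU z t))
      - 2 * S.bet / S.gam * S.normalizer z t
        * S.weightedTrace (z.ThetaHat t - z.Xi t) (z.lamHat t - z.lamEps t)) t := by
  have hγ := hS.gam_pos.ne'
  have h1 := h.hasDerivAt_errU_quadForm hS
  have h2 := hasDerivAt_weightedTrace (S := S) (M := fun s => z.Xi s - S.Theta)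
    (v := fun s => z.lamEps s - S.lam) (M' := fun i j => S.tunerDrive z t i (Sum.inl j))
    (v' := fun i => S.tunerDrive z t i (Sum.inr i)) (t := t)
    (fun i j => (h.xi i j).sub_const _) (fun i => (h.lamEps i).sub_const _)
  have h3 := hasDerivAt_weightedTrace (S := S) (M := fun s => z.ThetaHat s - z.Xi s)
    (v := fun s => z.lamHat s - z.lamEps s)
    (M' := fun i j => -S.bet * (z.ThetaHat t i j - z.Xi t i j) * S.normalizer z t
      - S.tunerDrive z t i (Sum.inl j))
    (v' := fun i => -S.bet * (z.lamHat t i - z.lamEps t i) * S.normalizer z t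
      - S.tunerDrive z t i (Sum.inr i)) (t := t)
    (fun i j => (h.thetaHat i j).fun_sub (h.xi i j)) (fun i => (h.lamHat i).fun_sub (h.lamEps i))
  refine ((h1.fun_add (h2.const_mul (1 / S.gam))).fun_add
    (h3.const_mul (1 / S.gam))).congr_deriv ?_
  rw [add_assoc, add_assoc, add_sub_assoc]
  congr 1
  rw [weightedTrace_eq, dotProduct, dotProduct]
  simp only [Finset.mul_sum, ← Finset.sum_add_distrib, ← Finset.sum_sub_distrib]
  refine Finset.sum_congr rfl fun i _ => ?_
  have d1 : ∀ j, S.tunerDrive z t i (Sum.inl j) = -(S.gam * S.drive z t i) * Phi z t j := by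
    intro j
    simp [tunerDrive, vecMulVec_apply, PhiA, drive]; ring
  have d2 : S.tunerDrive z t i (Sum.inr i) = S.gam * S.drive z t i * S.deltaU z t i := by
    simp [tunerDrive, vecMulVec_apply, PhiA, drive]; ring
  have e1 : (fun j => S.tunerDrive z t i (Sum.inl j))
      = (-(S.gam * S.drive z t i)) • Phi z t := by
    ext j; rw [d1]; rfl
  have e2 : (fun j => -S.bet * (z.ThetaHat t i j - z.Xi t i j) * S.normalizer z t
      - S.tunerDrive z t i (Sum.inl j)) = (-(S.bet * S.normalizer z t)) • (z.ThetaHat t - z.Xi t) i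
        + (S.gam * S.drive z t i) • Phi z t := by
    ext j
    rw [d1]
    simp only [Pi.add_apply, Pi.smul_apply, smul_eq_mul, Matrix.sub_apply]
    ring
  -- Splitting the mismatch through `Ξ_a`: the `Ξ_a - Θ_a` part cancels against the derivative of
  -- the first trace, while the `Θ̂_a - Ξ_a` part is met again in the derivative of the second.
  -- Hence the factor `4 = 2 + 2`.
  have e3 : S.mismatch z t i = S.lam i * ((z.ThetaHat t - z.Xi t) i ⬝ᵥ Phi z t
      + (z.Xi t - S.Theta) i ⬝ᵥ Phi z t)
      - ((z.lamHat t i - z.lamEps t i) + (z.lamEps t i - S.lam i)) * S.deltaU z t i := by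
    rw [← add_dotProduct]
    have : (z.ThetaHat t - z.Xi t) i + (z.Xi t - S.Theta) i = (z.ThetaHat t - S.Theta) i := by
      ext j; simp
    rw [this]
    simp only [mismatch, mulVec, Pi.sub_apply, Pi.mul_apply]
    ring_nf
  rw [e1, e2, e3, d2]
  simp only [dotProduct_add, dotProduct_smul, smul_eq_mul, Pi.sub_apply, Pi.mul_apply, mulVec]
  field_simp
  ring

end MSACSystem

/-! ### Dissipation of the Lyapunov function and finiteness of the gain deviation -/

namespace MSACSystem

variable {nx nu : ℕ} {S : MSACSystem nx nu} {z : MSACSignals nx nu} {t : ℝ}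

lemma exists_pos_le {n : ℕ} {f : Fin n → ℝ} (hf : ∀ i, 0 < f i) : ∃ l, 0 < l ∧ ∀ i, l ≤ f i := by
  have h : ∀ᶠ l in 𝓝[>] (0 : ℝ), ∀ i, l ≤ f i :=
    eventually_all.2 fun i => Filter.mem_of_superset (Ioc_mem_nhdsGT (hf i)) fun x hx => hx.2
  obtain ⟨l, h1, h2⟩ := (h.and self_mem_nhdsWithin).exists
  exact ⟨l, h2, h1⟩

/-- The scaling of `Q` leaves a margin over `max (1, λ_max)`. -/
lemma Standing.exists_margin (hS : S.Standing) :
    ∃ L c : ℝ, 0 ≤ L ∧ 0 < c ∧ (∀ i, S.lam i ≤ L ∧ 1 ≤ L) ∧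
      ∀ e, (L + c) * euclNorm e ^ 2 ≤ e ⬝ᵥ S.Q *ᵥ e := by
  rcases isEmpty_or_nonempty (Fin nu) with h | ⟨⟨i₀⟩⟩
  · obtain ⟨c, hc, hQ⟩ := hS.Q_posDef.exists_mul_le
    exact ⟨0, c, le_rfl, hc, fun i => h.elim i, by simpa using hQ⟩
  · obtain ⟨l, hl, hle⟩ := exists_pos_le hS.lam_pos
    have hc1 : min l 1 ≤ 1 := min_le_right _ _
    have hcl : min l 1 ≤ l := min_le_left _ _
    -- Since `qMin ≥ 1 + λ_i`, giving away `min l 1 ≤ 1` keeps `L ≥ λ_i`, and giving away `min l 1 ≤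
    -- λ_i` keeps `L ≥ 1`.
    refine ⟨S.qMin - min l 1, min l 1, ?_, lt_min hl one_pos, fun i => ⟨?_, ?_⟩, fun e => ?_⟩
    · linarith [hS.Q_scale i₀, hS.lam_pos i₀]
    · linarith [hS.Q_scale i]
    · linarith [hS.Q_scale i, hle i]
    · rw [sub_add_cancel]
      exact hS.Q_posDef.isHermitian.minEig_mul_le e

lemma weightedTrace_nonneg (hS : S.Standing) (M : Matrix (Fin nu) (Fin nx ⊕ Fin nu) ℝ)
    (v : Fin nu → ℝ) : 0 ≤ S.weightedTrace M v := by
  rw [weightedTrace_eq]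
  refine Finset.sum_nonneg fun i _ => add_nonneg (mul_nonneg (hS.lam_pos i).le ?_) (sq_nonneg _)
  rw [← euclNorm_sq]; exact sq_nonneg _

lemma euclNorm_drive_le (hS : S.Standing) (x : Fin nx → ℝ) :
    euclNorm ((S.Bpᵀ * S.P) *ᵥ x) ≤ frobNorm (S.P * S.Bp) * euclNorm x := by
  rw [← frobNorm_transpose, transpose_mul, hS.P_transpose]
  exact euclNorm_mulVec_le_frobNorm _ _

lemma PhiA_dotProduct_self (z : MSACSignals nx nu) (t : ℝ) :
    S.PhiA z t ⬝ᵥ S.PhiA z t = Phi z t ⬝ᵥ Phi z t + S.deltaU z t ⬝ᵥ S.deltaU z t := by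
  simp [PhiA, sumElim_dotProduct_sumElim]

/-- Cauchy–Schwarz estimate of the coupling terms by the weighted trace. -/
lemma euclNorm_coupling_sq_le (hS : S.Standing) {L : ℝ} (hL0 : 0 ≤ L)
    (hL : ∀ i, S.lam i ≤ L ∧ 1 ≤ L)
    (M : Matrix (Fin nu) (Fin nx ⊕ Fin nu) ℝ) (v : Fin nu → ℝ) (φ : Fin nx ⊕ Fin nu → ℝ)
    (δ : Fin nu → ℝ) :
    euclNorm (S.lam * (M *ᵥ φ) - v * δ) ^ 2
      ≤ L * S.weightedTrace M v * (φ ⬝ᵥ φ + δ ⬝ᵥ δ) := by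
  rw [weightedTrace_eq, euclNorm_sq, dotProduct, Finset.mul_sum, Finset.sum_mul]
  refine Finset.sum_le_sum fun i _ => ?_
  simp only [Pi.sub_apply, Pi.mul_apply, mulVec]
  obtain ⟨h1, h2⟩ := hL i
  have hl := hS.lam_pos i
  set m := (fun j => M i j) ⬝ᵥ φ with hm
  have hcs : m ^ 2 ≤ (M i ⬝ᵥ M i) * (φ ⬝ᵥ φ) := by
    have h := abs_dotProduct_le (M i) φ
    have h2 : (M i ⬝ᵥ φ) ^ 2 ≤ (euclNorm (M i) * euclNorm φ) ^ 2 :=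
      sq_le_sq' (abs_le.1 h).1 (abs_le.1 h).2
    rwa [mul_pow, euclNorm_sq, euclNorm_sq] at h2
  have hδ : δ i ^ 2 ≤ δ ⬝ᵥ δ := by
    rw [← euclNorm_sq]
    exact sq_le_sq' (abs_le.1 (abs_apply_le_euclNorm δ i)).1 (abs_le.1 (abs_apply_le_euclNorm δ i)).2
  have hA : 0 ≤ M i ⬝ᵥ M i := by rw [← euclNorm_sq]; exact sq_nonneg _
  have hF : 0 ≤ φ ⬝ᵥ φ := by rw [← euclNorm_sq]; exact sq_nonneg _
  have hD : 0 ≤ δ ⬝ᵥ δ := (sq_nonneg _).trans hδ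
  set A := M i ⬝ᵥ M i
  set F := φ ⬝ᵥ φ
  set D := δ ⬝ᵥ δ
  set l := S.lam i
  set w := v i
  set e := δ i
  -- Cauchy–Schwarz with weight `l`, using only `m² ≤ A F`. Multiplied by `A`, the difference
  -- becomes `l (A e + w m)² + l (l A + w²)(A F - m²)`; the case `A = 0` forces `m = 0`.
  have k1 : (l * m - w * e) ^ 2 ≤ (l * A + w ^ 2) * (l * F + e ^ 2) := by
    rcases hA.eq_or_lt with hA0 | hA0
    · have hm0 : m ^ 2 = 0 := le_antisymm (by rw [← hA0, zero_mul] at hcs; exact hcs) (sq_nonneg _)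
      have hm1 : m = 0 := by simpa using hm0
      rw [hm1, ← hA0]
      nlinarith [mul_nonneg (sq_nonneg w) (mul_nonneg hl.le hF)]
    · have : 0 ≤ A * ((l * A + w ^ 2) * (l * F + e ^ 2) - (l * m - w * e) ^ 2) := by
        nlinarith [mul_nonneg hl.le (sq_nonneg (A * e + w * m)),
          mul_nonneg (mul_nonneg hl.le (add_nonneg (mul_nonneg hl.le hA) (sq_nonneg w)))
            (sub_nonneg.2 hcs)]
      nlinarith [nonneg_of_mul_nonneg_right this hA0]
  have k2 : l * F + e ^ 2 ≤ L * (F + D) := by nlinarith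
  have hT : 0 ≤ l * A + w ^ 2 := add_nonneg (mul_nonneg hl.le hA) (sq_nonneg _)
  have := mul_le_mul_of_nonneg_left k2 hT
  nlinarith

/-- The coupling terms are dominated by the quadratic damping of the high-order tuner. -/
lemma coupling_le (hS : S.Standing) {L : ℝ} (hL0 : 0 ≤ L) (hL : ∀ i, S.lam i ≤ L ∧ 1 ≤ L)
    (z : MSACSignals nx nu) (t : ℝ) :
    4 * (S.drive z t ⬝ᵥ (S.lam * ((z.ThetaHat t - z.Xi t) *ᵥ Phi z t)
        - (z.lamHat t - z.lamEps t) * S.deltaU z t))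
      - 2 * S.bet / S.gam * S.normalizer z t
        * S.weightedTrace (z.ThetaHat t - z.Xi t) (z.lamHat t - z.lamEps t)
      ≤ L * euclNorm (errU z t) ^ 2 := by
  set T := S.weightedTrace (z.ThetaHat t - z.Xi t) (z.lamHat t - z.lamEps t)
  set g := S.lam * ((z.ThetaHat t - z.Xi t) *ᵥ Phi z t) - (z.lamHat t - z.lamEps t) * S.deltaU z t
    with hg
  have hT : 0 ≤ T := weightedTrace_nonneg hS _ _
  have hgs := euclNorm_coupling_sq_le hS hL0 hL (z.ThetaHat t - z.Xi t) (z.lamHat t - z.lamEps t)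
    (Phi z t) (S.deltaU z t)
  rw [← PhiA_dotProduct_self, ← hg] at hgs
  have hw : euclNorm (S.drive z t) ≤ _ := euclNorm_drive_le hS (errU z t)
  rw [normalizer]
  have hF : 0 ≤ S.PhiA z t ⬝ᵥ S.PhiA z t := by rw [← euclNorm_sq]; exact sq_nonneg _
  set F := S.PhiA z t ⬝ᵥ S.PhiA z t
  set b := frobNorm (S.P * S.Bp)
  set e := euclNorm (errU z t)
  have hb : 0 ≤ b := frobNorm_nonneg _
  have he : 0 ≤ e := euclNorm_nonneg _
  have hμ : 4 * b ^ 2 ≤ 2 * S.bet / S.gam * S.mu := by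
    have h1 := mul_le_mul_of_nonneg_left hS.mu_ge
      (show 0 ≤ 2 * S.bet / S.gam from
        div_nonneg (mul_nonneg zero_le_two hS.bet_pos.le) hS.gam_pos.le)
    have h2 : 2 * S.bet / S.gam * (2 * S.gam / S.bet * b ^ 2) = 4 * b ^ 2 := by
      have := hS.bet_pos.ne'
      have := hS.gam_pos.ne'
      field_simp
      ring
    rwa [h2] at h1
  have hdamp : 4 * b ^ 2 * (F * T) ≤ 2 * S.bet / S.gam * (1 + S.mu * F) * T := by
    have h1 := mul_le_mul_of_nonneg_right hμ (mul_nonneg hF hT)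
    have h2 : 0 ≤ 2 * S.bet / S.gam * T := mul_nonneg
      (div_nonneg (mul_nonneg zero_le_two hS.bet_pos.le) hS.gam_pos.le) hT
    nlinarith
  -- Arithmetic-geometric mean applied to `4 b e √(L F T)`. The weights are such that the second
  -- term is what `μ` was chosen to absorb and the first is what the scaling of `Q` absorbs.
  have hcross : 4 * (S.drive z t ⬝ᵥ g) ≤ L * e ^ 2 + 4 * b ^ 2 * (F * T) := by
    refine abs_le_of_sq_le_sq' ?_ (by positivity) |>.2
    have h1 := abs_dotProduct_le (S.drive z t) g
    have h2 : (S.drive z t ⬝ᵥ g) ^ 2 ≤ (euclNorm (S.drive z t) * euclNorm g) ^ 2 :=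
      sq_le_sq' (abs_le.1 h1).1 (abs_le.1 h1).2
    have h3 : euclNorm (S.drive z t) ^ 2 ≤ (b * e) ^ 2 :=
      pow_le_pow_left₀ (euclNorm_nonneg _) hw 2
    rw [mul_pow] at h2
    have h4 := mul_le_mul h3 hgs (sq_nonneg _) (sq_nonneg _)
    nlinarith [sq_nonneg (L * e ^ 2 - 4 * b ^ 2 * (F * T))]
  linarith

/-- Along the closed loop, `V̇ ≤ -c ‖e_u‖²`. -/
lemma LoopAt.exists_hasDerivAt_V (hS : S.Standing) {L c : ℝ} (hL0 : 0 ≤ L)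
    (hL : ∀ i, S.lam i ≤ L ∧ 1 ≤ L) (hQ : ∀ e, (L + c) * euclNorm e ^ 2 ≤ e ⬝ᵥ S.Q *ᵥ e)
    (h : S.LoopAt z t) :
    ∃ V', HasDerivAt (S.V z) V' t ∧ V' ≤ -(c * euclNorm (errU z t) ^ 2) := by
  refine ⟨_, h.hasDerivAt_V hS, ?_⟩
  have h1 := coupling_le hS hL0 hL z t
  have h2 := hQ (errU z t)
  linarith

lemma V_nonneg (hS : S.Standing) (z : MSACSignals nx nu) (t : ℝ) : 0 ≤ S.V z t := by
  obtain ⟨p, hp, hP⟩ := hS.P_posDef.exists_mul_le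
  have h1 : 0 ≤ errU z t ⬝ᵥ S.P *ᵥ errU z t :=
    (mul_nonneg hp.le (sq_nonneg _)).trans (hP _)
  have hγ : 0 ≤ 1 / S.gam := (one_div_pos.2 hS.gam_pos).le
  exact add_nonneg (add_nonneg h1 (mul_nonneg hγ (weightedTrace_nonneg hS _ _)))
    (mul_nonneg hγ (weightedTrace_nonneg hS _ _))

lemma errU_quadForm_le_V (hS : S.Standing) (z : MSACSignals nx nu) (t : ℝ) :
    errU z t ⬝ᵥ S.P *ᵥ errU z t ≤ S.V z t := by
  have hγ : 0 ≤ 1 / S.gam := (one_div_pos.2 hS.gam_pos).le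
  have h1 := mul_nonneg hγ (weightedTrace_nonneg hS (z.Xi t - S.Theta) (z.lamEps t - S.lam))
  have h2 := mul_nonneg hγ
    (weightedTrace_nonneg hS (z.ThetaHat t - z.Xi t) (z.lamHat t - z.lamEps t))
  rw [V]; linarith

lemma frobNorm_fromCols_diagonal_sq (M : Matrix (Fin nu) (Fin nx ⊕ Fin nu) ℝ) (v : Fin nu → ℝ) :
    frobNorm (fromCols M (diagonal v)) ^ 2 = ∑ i, (M i ⬝ᵥ M i + v i ^ 2) := by
  rw [frobNorm_sq]
  refine Finset.sum_congr rfl fun i _ => ?_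
  rw [Fintype.sum_sum_type (fun j => fromCols M (diagonal v) i j ^ 2)]
  simp only [fromCols_apply_inl, fromCols_apply_inr, dotProduct, sq]
  congr 1
  rw [Finset.sum_eq_single i]
  · simp
  · intro j _ hj; simp [diagonal_apply_ne' _ hj]
  · simp

lemma mul_frobNorm_sq_le_weightedTrace {l : ℝ} (hl : ∀ i, l ≤ S.lam i) (hl1 : Fin nu → l ≤ 1)
    (M : Matrix (Fin nu) (Fin nx ⊕ Fin nu) ℝ) (v : Fin nu → ℝ) :
    l * frobNorm (fromCols M (diagonal v)) ^ 2 ≤ S.weightedTrace M v := by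
  rw [weightedTrace_eq, frobNorm_fromCols_diagonal_sq, Finset.mul_sum]
  refine Finset.sum_le_sum fun i _ => ?_
  have hA : 0 ≤ M i ⬝ᵥ M i := by rw [← euclNorm_sq]; exact sq_nonneg _
  have h1 := mul_le_mul_of_nonneg_right (hl i) hA
  have h2 := mul_le_mul_of_nonneg_right (hl1 i) (sq_nonneg (v i))
  linarith

lemma ThetaHatA_sub_ThetaA (z : MSACSignals nx nu) (t : ℝ) :
    ThetaHatA z t - S.ThetaA = fromCols (z.Xi t - S.Theta) (diagonal (z.lamEps t - S.lam))
      + fromCols (z.ThetaHat t - z.Xi t) (diagonal (z.lamHat t - z.lamEps t)) := by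
  ext i j
  rcases j with j | j
  · simp [ThetaHatA, ThetaA]
  · by_cases h : i = j
    · subst h; simp [ThetaHatA, ThetaA, Lam]
    · simp [ThetaHatA, ThetaA, Lam, diagonal_apply_ne _ h]

/-- The parameter deviations are controlled by `V`. -/
lemma frobNorm_dev_sq_le {l : ℝ} (hS : S.Standing) (hl0 : 0 < l) (hl : ∀ i, l ≤ S.lam i)
    (hl1 : Fin nu → l ≤ 1) (z : MSACSignals nx nu) (t : ℝ) :
    frobNorm (fromCols (z.Xi t - S.Theta) (diagonal (z.lamEps t - S.lam))) ^ 2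
      + frobNorm (fromCols (z.ThetaHat t - z.Xi t) (diagonal (z.lamHat t - z.lamEps t))) ^ 2
      ≤ S.gam / l * S.V z t := by
  have h1 := mul_frobNorm_sq_le_weightedTrace hl hl1 (z.Xi t - S.Theta) (z.lamEps t - S.lam)
  have h2 := mul_frobNorm_sq_le_weightedTrace hl hl1 (z.ThetaHat t - z.Xi t)
    (z.lamHat t - z.lamEps t)
  obtain ⟨p, hp, hP⟩ := hS.P_posDef.exists_mul_le
  have h3 : 0 ≤ errU z t ⬝ᵥ S.P *ᵥ errU z t := (mul_nonneg hp.le (sq_nonneg _)).trans (hP _)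
  have hγ := hS.gam_pos
  rw [div_mul_eq_mul_div, le_div_iff₀ hl0, V, mul_add, mul_add, ← mul_assoc S.gam (1 / S.gam),
    ← mul_assoc S.gam (1 / S.gam), mul_one_div_cancel hγ.ne']
  have := mul_nonneg hγ.le h3
  linarith

/-- The deviation is a sum of two terms whose squares together are controlled by `V`, and `a + b ≤
√2 √(a² + b²)`. This is the source of the factor `√2` in the gain condition. -/
lemma frobNorm_ThetaHatA_sub_le {l : ℝ} (hS : S.Standing) (hl0 : 0 < l) (hl : ∀ i, l ≤ S.lam i)
    (hl1 : Fin nu → l ≤ 1) (z : MSACSignals nx nu) (t : ℝ) :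
    frobNorm (ThetaHatA z t - S.ThetaA) ≤ √2 * √(S.gam / l * S.V z t) := by
  rw [ThetaHatA_sub_ThetaA, ← Real.sqrt_mul zero_le_two]
  refine (frobNorm_add_le _ _).trans (Real.le_sqrt_of_sq_le ?_)
  have := frobNorm_dev_sq_le hS hl0 hl hl1 z t
  nlinarith [sq_nonneg (frobNorm (fromCols (z.Xi t - S.Theta) (diagonal (z.lamEps t - S.lam))) -
    frobNorm (fromCols (z.ThetaHat t - z.Xi t) (diagonal (z.lamHat t - z.lamEps t))))]

section Trajectory

variable {t0 : ℝ} {T : EReal}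

lemma Icc_subset_timeDomain (ht : t ∈ timeDomain t0 T) : Set.Icc t0 t ⊆ timeDomain t0 T :=
  fun _ hs => ⟨hs.1, (EReal.coe_le_coe_iff.2 hs.2).trans_lt ht.2⟩

lemma IsTrajectory.continuousOn_errU (h : S.IsTrajectory z t0 T) :
    ContinuousOn (errU z) (timeDomain t0 T) :=
  (h.xp_cont.sub h.xm_cont).sub h.eDelta_cont

lemma continuousOn_weightedTrace {M : ℝ → Matrix (Fin nu) (Fin nx ⊕ Fin nu) ℝ}
    {v : ℝ → Fin nu → ℝ} {s : Set ℝ} (hM : ContinuousOn M s) (hv : ContinuousOn v s) :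
    ContinuousOn (fun t => S.weightedTrace (M t) (v t)) s := by
  have hMi : ∀ i j, ContinuousOn (fun t => M t i j) s := fun i j =>
    continuousOn_pi.1 (continuousOn_pi.1 hM i) j
  have hvi : ∀ i, ContinuousOn (fun t => v t i) s := fun i => continuousOn_pi.1 hv i
  simp only [weightedTrace_eq, dotProduct]
  refine continuousOn_finsetSum _ fun i _ => ?_
  refine (continuousOn_const.mul (continuousOn_finsetSum _ fun j _ => ?_)).add ?_
  · exact (hMi i j).mul (hMi i j)
  · exact (hvi i).pow 2

lemma IsTrajectory.continuousOn_V (h : S.IsTrajectory z t0 T) :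
    ContinuousOn (S.V z) (timeDomain t0 T) := by
  have hΘ : ContinuousOn (fun _ : ℝ => S.Theta) (timeDomain t0 T) := continuousOn_const
  have hl : ContinuousOn (fun _ : ℝ => S.lam) (timeDomain t0 T) := continuousOn_const
  have h1 := h.continuousOn_errU.quadForm S.P
  have h2 := continuousOn_weightedTrace (S := S) (h.xi_cont.fun_sub hΘ) (h.lamEps_cont.fun_sub hl)
  have h3 := continuousOn_weightedTrace (S := S) (h.thetaHat_cont.fun_sub h.xi_cont) (h.lamHat_cont.fun_sub h.lamEps_cont)
  unfold V
  exact (h1.add (continuousOn_const.mul h2)).add (continuousOn_const.mul h3)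

lemma IsTrajectory.V_le (hS : S.Standing) (h : S.IsTrajectory z t0 T) (ht : t ∈ timeDomain t0 T) :
    S.V z t ≤ S.V z t0 := by
  obtain ⟨L, c, hL0, hc, hL, hQ⟩ := hS.exists_margin
  obtain ⟨E, hE, hloop⟩ := h.loop
  -- The monotonicity lemma takes the derivative as a total function; the default `0` fills the
  -- times at which the loop equations are not assumed.
  have key : ∀ s, ∃ V', s ∈ timeDomain t0 T \ E → HasDerivAt (S.V z) V' s ∧ V' ≤ 0 := fun s => by
    by_cases hs : s ∈ timeDomain t0 T \ E
    · obtain ⟨V', h1, h2⟩ := (hloop s hs).exists_hasDerivAt_V hS hL0 hL hQ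
      exact ⟨V', fun _ => ⟨h1, h2.trans (neg_nonpos.2 (by positivity))⟩⟩
    · exact ⟨0, fun hs' => absurd hs' hs⟩
  choose V' hV' using key
  exact le_of_hasDerivAt_nonpos ht.1 (h.continuousOn_V.mono (Icc_subset_timeDomain ht)) hE
    fun s hs => hV' s ⟨Icc_subset_timeDomain ht ⟨hs.1.1.le, hs.1.2.le⟩, hs.2⟩

lemma IsTrajectory.frobNorm_le (hS : S.Standing) (h : S.IsTrajectory z t0 T) {l : ℝ} (hl0 : 0 < l)
    (hl : ∀ i, l ≤ S.lam i) (hl1 : Fin nu → l ≤ 1) (ht : t ∈ timeDomain t0 T) :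
    frobNorm (ThetaHatA z t - S.ThetaA) ≤ √2 * √(S.gam / l * S.V z t0) := by
  refine (frobNorm_ThetaHatA_sub_le hS hl0 hl hl1 z t).trans ?_
  have := mul_le_mul_of_nonneg_left (h.V_le hS ht) (div_pos hS.gam_pos hl0).le
  gcongr

lemma IsTrajectory.bddAbove_frobNorm (hS : S.Standing) (h : S.IsTrajectory z t0 T) :
    BddAbove ((fun t => frobNorm (ThetaHatA z t - S.ThetaA)) '' timeDomain t0 T) := by
  obtain ⟨l, hl, hle⟩ := exists_pos_le hS.lam_pos
  refine ⟨√2 * √(S.gam / min l 1 * S.V z t0), ?_⟩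
  rintro _ ⟨t, ht, rfl⟩
  exact h.frobNorm_le hS (lt_min hl one_pos) (fun i => (min_le_left _ _).trans (hle i))
    (fun _ => min_le_right _ _) ht

lemma IsTrajectory.frobNorm_le_KMax (hS : S.Standing) (h : S.IsTrajectory z t0 T)
    (ht : t ∈ timeDomain t0 T) : frobNorm (ThetaHatA z t - S.ThetaA) ≤ S.KMax z t0 T := by
  have hb := h.bddAbove_frobNorm hS
  rw [Set.image_eq_range] at hb
  exact le_ciSup hb ⟨t, ht⟩

end Trajectory

lemma lamMin_spec (hS : S.Standing) (i₀ : Fin nu) :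
    0 < S.lamMin ∧ (∀ i, S.lamMin ≤ S.lam i) ∧ S.lamMin ≤ 1 := by
  have hA : S.LamA = diagonal (Sum.elim S.lam 1) := by
    rw [LamA, Lam, ← diagonal_one, fromBlocks_diagonal]; rfl
  have hpd : S.LamA.PosDef := by
    rw [hA]
    refine PosDef.diagonal ?_
    rintro (i | i)
    · exact hS.lam_pos i
    · exact one_pos
  have : Nonempty (Fin nu ⊕ Fin nu) := ⟨Sum.inl i₀⟩
  refine ⟨hpd.minEig_pos, fun i => ?_, ?_⟩
  · simpa [lamMin, hA] using hpd.isHermitian.minEig_le_diag (Sum.inl i)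
  · simpa [lamMin, hA] using hpd.isHermitian.minEig_le_diag (Sum.inr i₀)

end MSACSystem

/-! ### The saturation map and the gain margin -/

section Saturation

variable {n : ℕ}

lemma exists_ballSat_eq_smul {uMax : ℝ} (hu : 0 < uMax) (u : Fin n → ℝ) :
    ∃ s, 0 < s ∧ s ≤ 1 ∧ ballSat uMax u = s • u ∧ (s = 1 ∨ s ≤ 1 ∧ s * euclNorm u = uMax) := by
  rw [ballSat]
  split_ifs with h
  · exact ⟨1, one_pos, le_rfl, (one_smul _ _).symm, Or.inl rfl⟩
  · push Not at h
    have h0 : 0 < euclNorm u := hu.trans h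
    have h1 : uMax / euclNorm u ≤ 1 := (div_le_one h0).2 h.le
    exact ⟨uMax / euclNorm u, div_pos hu h0, h1, rfl, Or.inr ⟨h1, div_mul_cancel₀ _ h0.ne'⟩⟩

lemma euclNorm_ballSat_le {uMax : ℝ} (hu : 0 < uMax) (u : Fin n → ℝ) :
    euclNorm (ballSat uMax u) ≤ euclNorm u := by
  obtain ⟨s, h0, h1, he, -⟩ := exists_ballSat_eq_smul hu u
  rw [he, euclNorm_smul, abs_of_pos h0]
  exact mul_le_of_le_one_left (euclNorm_nonneg u) h1

end Saturation

/-- The gain deviation admitted by the definition of `KBar`, up to the factor `√2`, leaves room for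
the coupling with the reference input. -/
lemma gain_margin {q p k κ r uMax ρ D K KB a : ℝ} (hp : 0 < p) (hk : 0 ≤ k) (hκ : 0 ≤ κ)
    (hr : 0 ≤ r) (hu : 0 < uMax) (hρ : 1 ≤ ρ) (hD : 0 < D) (hK : 0 < K)
    (ha : a = uMax * K / (k + K))
    (hKB : KB = (q - ρ / a * (3 * κ * r + 2 * uMax) * D) / (3 * p + 3 * ρ / a * (r + 1) * D))
    (hlt : K < √2 * KB) :
    p * K + (K + κ) * r * (ρ / a * D) < √2 / 3 * (q - 2 * (D * (k + K) / K)) := by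
  have hs1 : 1 ≤ √2 := by rw [Real.one_le_sqrt]; norm_num
  have ha0 : 0 < a := by rw [ha]; positivity
  set m := ρ / a * D with hm
  have hm0 : 0 < m := by positivity
  have hden : 3 * p + 3 * ρ / a * (r + 1) * D = 3 * p + 3 * m * (r + 1) := by rw [hm]; ring
  have hnum : q - ρ / a * (3 * κ * r + 2 * uMax) * D = q - m * (3 * κ * r + 2 * uMax) := by
    rw [hm]; ring
  rw [hden, hnum, eq_div_iff (by positivity)] at hKB
  have h1 : K * (3 * p + 3 * m * (r + 1)) < √2 * (q - m * (3 * κ * r + 2 * uMax)) := by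
    rw [← hKB]
    calc _ < √2 * KB * (3 * p + 3 * m * (r + 1)) := mul_lt_mul_of_pos_right hlt (by positivity)
      _ = _ := mul_assoc _ _ _
  -- The term `2 * uMax` in the numerator of `KBar` pays for the quantity `D (k + K) / K`; here `ρ ≥
  -- 1` is used.
  have h2 : D * (k + K) / K ≤ m * uMax := by
    have : m * uMax = ρ * (D * (k + K) / K) := by rw [hm, ha]; field_simp
    rw [this]
    exact le_mul_of_one_le_left (by positivity) hρ
  have h3 : 3 * (m * κ * r) ≤ √2 * (3 * (m * κ * r)) := le_mul_of_one_le_left (by positivity) hs1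
  have h4 := mul_le_mul_of_nonneg_left h2 (show 0 ≤ √2 by positivity)
  have h5 : 0 < m * K := mul_pos hm0 hK
  nlinarith

lemma specNorm_eq_zero_of_isEmpty {ι κ : Type*} [Fintype ι] [Fintype κ] [DecidableEq κ]
    (A : Matrix ι κ ℝ) (h : IsEmpty ι ∨ IsEmpty κ) : specNorm A = 0 := by
  have : A = 0 := by
    ext i j
    rcases h with h | h
    exacts [h.elim i, h.elim j]
  rw [this, specNorm]
  open scoped Matrix.Norms.L2Operator in exact norm_zero

/-! ### Invariance of the state ball -/

namespace MSACSystem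

variable {nx nu : ℕ} {S : MSACSystem nx nu} {z : MSACSignals nx nu} {t : ℝ}

lemma ThetaHatA_sub_ThetaA' (z : MSACSignals nx nu) (t : ℝ) :
    ThetaHatA z t - S.ThetaA
      = fromCols (z.ThetaHat t - S.Theta) (diagonal (z.lamHat t - S.lam)) := by
  ext i j
  rcases j with j | j
  · simp [ThetaHatA, ThetaA]
  · by_cases h : i = j
    · subst h; simp [ThetaHatA, ThetaA, Lam]
    · simp [ThetaHatA, ThetaA, Lam, diagonal_apply_ne _ h]

lemma frobNorm_le_frobNorm_fromCols (M : Matrix (Fin nu) (Fin nx ⊕ Fin nu) ℝ) (v : Fin nu → ℝ) :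
    frobNorm M ≤ frobNorm (fromCols M (diagonal v)) := by
  refine abs_le_of_sq_le_sq' ?_ (frobNorm_nonneg _) |>.2
  rw [frobNorm_fromCols_diagonal_sq, frobNorm_sq]
  refine Finset.sum_le_sum fun i _ => ?_
  have : ∑ j, M i j ^ 2 = M i ⬝ᵥ M i := by simp [dotProduct, sq]
  rw [this]
  linarith [sq_nonneg (v i)]

lemma abs_le_frobNorm_fromCols (M : Matrix (Fin nu) (Fin nx ⊕ Fin nu) ℝ) (v : Fin nu → ℝ)
    (i : Fin nu) : |v i| ≤ frobNorm (fromCols M (diagonal v)) := by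
  refine abs_le_of_sq_le_sq' ?_ (frobNorm_nonneg _) |>.2
  rw [frobNorm_fromCols_diagonal_sq, sq_abs]
  have hA : ∀ i, 0 ≤ M i ⬝ᵥ M i := fun i => by rw [← euclNorm_sq]; exact sq_nonneg _
  have := Finset.single_le_sum (f := fun i => M i ⬝ᵥ M i + v i ^ 2)
    (fun i _ => add_nonneg (hA i) (sq_nonneg _)) (Finset.mem_univ i)
  linarith [hA i]

/-- Consequences of a positive radius `xMax`. -/
lemma nondegenerate (hS : S.Standing) {K x : ℝ} (hK : 0 ≤ K) (hx : 0 ≤ x)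
    (h : x < S.xMax K / S.rho) :
    0 < S.PB ∧ 0 < K ∧ 0 < |S.qMin - 2 * S.PB * specNorm S.Kx| ∧ 0 < S.xMax K
      ∧ Nonempty (Fin nx) ∧ Nonempty (Fin nu) := by
  have hk : 0 ≤ specNorm S.Kx := specNorm_nonneg _
  have hPB : 0 ≤ S.PB := specNorm_nonneg _
  have hρ : 0 ≤ S.rho := Real.sqrt_nonneg _
  have hpos : 0 < S.xMax K / S.rho := hx.trans_lt h
  -- Division by zero yields `0`, so any degeneracy in the definitions of `a0` and `xMax` would make
  -- the radius zero and contradict the strict inequality in `h`.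
  have hne : S.xMax K ≠ 0 := fun h0 => by rw [h0, zero_div] at hpos; exact lt_irrefl _ hpos
  have hPB' : 0 < S.PB := hPB.lt_of_ne fun h0 => hne (by rw [xMax, ← h0]; simp)
  refine ⟨hPB', hK.lt_of_ne fun h0 => hne (by rw [xMax, a0, ← h0]; simp), ?_, ?_, ?_, ?_⟩
  · exact (abs_nonneg _).lt_of_ne fun h0 => hne (by rw [xMax, ← h0]; simp)
  · have : 0 ≤ S.xMax K := by
      have := hS.uMax_pos
      rw [xMax, a0]; positivity
    exact this.lt_of_ne hne.symm
  · by_contra hc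
    exact hPB'.ne' (specNorm_eq_zero_of_isEmpty _ (Or.inl (not_nonempty_iff.1 hc)))
  · by_contra hc
    exact hPB'.ne' (specNorm_eq_zero_of_isEmpty _ (Or.inr (not_nonempty_iff.1 hc)))

lemma pMin_pos [Nonempty (Fin nx)] (hS : S.Standing) : 0 < S.pMin := hS.P_posDef.minEig_pos

lemma pMin_le_pMax [Nonempty (Fin nx)] (hS : S.Standing) : S.pMin ≤ S.pMax := by
  obtain ⟨i⟩ := ‹Nonempty (Fin nx)›
  have h1 := hS.P_posDef.isHermitian.minEig_mul_le (Pi.single i 1)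
  have h2 := hS.P_posDef.isHermitian.le_maxEig_mul (Pi.single i 1)
  have h3 : euclNorm (Pi.single i (1 : ℝ)) ^ 2 = 1 := by rw [euclNorm_sq]; simp
  rw [h3, mul_one] at h1 h2
  exact h1.trans h2

lemma one_le_rho [Nonempty (Fin nx)] (hS : S.Standing) : 1 ≤ S.rho := by
  rw [rho, Real.one_le_sqrt, one_le_div (pMin_pos hS)]
  exact pMin_le_pMax hS

lemma qMin_pos [Nonempty (Fin nx)] (hS : S.Standing) : 0 < S.qMin := hS.Q_posDef.minEig_pos

section Trajectory

variable {t0 : ℝ} {T : EReal}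

lemma KMax_nonneg (S : MSACSystem nx nu) (z : MSACSignals nx nu) (t0 : ℝ) (T : EReal) :
    0 ≤ S.KMax z t0 T :=
  Real.iSup_nonneg fun _ => frobNorm_nonneg _

lemma IsTrajectory.KMax_lt (hS : S.Standing) (h : S.IsTrajectory z t0 T) (hT : (t0 : EReal) < T)
    (i₀ : Fin nu) {B : ℝ} (hV : √(S.V z t0) < B * √(S.lamMin / S.gam)) :
    S.KMax z t0 T < √2 * B := by
  obtain ⟨hl0, hl, hl1⟩ := lamMin_spec hS i₀
  have hγ := hS.gam_pos
  have : Nonempty (timeDomain t0 T) := ⟨⟨t0, le_rfl, hT⟩⟩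
  refine (ciSup_le fun t => h.frobNorm_le hS hl0 hl (fun _ => hl1) t.2).trans_lt ?_
  refine mul_lt_mul_of_pos_left ?_ (by positivity)
  have h1 : S.gam / S.lamMin = (S.lamMin / S.gam)⁻¹ := (inv_div _ _).symm
  rw [h1, Real.sqrt_mul (by positivity), Real.sqrt_inv, inv_mul_lt_iff₀ (by positivity), mul_comm]
  exact hV

/-- Decrease of `x_pᵀ P x_p` in the annulus where the reference input is dominated. -/
lemma LoopAt.exists_hasDerivAt_xp (hS : S.Standing) (h : S.LoopAt z t) {K X₁ : ℝ} (hK : 0 < K)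
    (hPB : 0 < S.PB) (hD : 0 < |S.qMin - 2 * S.PB * specNorm S.Kx|) (hX₁ : 0 < X₁)
    (hG : S.PB * (K + (K + specNorm S.Kr) * S.rMax / X₁) < √2 / 3 * (S.qMin
      - 2 * (|S.qMin - 2 * S.PB * specNorm S.Kx| * (specNorm S.Kx + K) / K)))
    (hθ : frobNorm (ThetaHatA z t - S.ThetaA) ≤ K) (hr : euclNorm (z.r t) ≤ S.rMax)
    (hX : X₁ ≤ euclNorm (z.xp t)) (hXm : euclNorm (z.xp t) ≤ S.xMax K) :
    ∃ W', HasDerivAt (fun s => z.xp s ⬝ᵥ S.P *ᵥ z.xp s) W' t ∧ W' < 0 := by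
  refine ⟨_, (h.plant' hS).quadForm hS.P_transpose, ?_⟩
  have hk : 0 ≤ specNorm S.Kx := specNorm_nonneg _
  have hκ : 0 ≤ specNorm S.Kr := specNorm_nonneg _
  have hr0 := hS.rMax_nonneg
  set X := euclNorm (z.xp t) with hXdef
  have hX0 : 0 < X := hX₁.trans_le hX
  set n := (S.P * S.Bp * S.Lam)ᵀ *ᵥ z.xp t with hn
  set y := S.Kx *ᵥ z.xp t with hy
  set g := (z.ThetaHat t - S.Theta) *ᵥ Phi z t + S.Kr *ᵥ z.r t with hg
  have hu : u z t = y + g := by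
    rw [hg, sub_mulVec, Theta_mulVec_Phi, u]; abel
  obtain ⟨s, hs0, -, hsat, hs⟩ := exists_ballSat_eq_smul hS.uMax_pos (u z t)
  rw [hu] at hsat hs ⊢
  rw [hsat, dotProduct_add, mul_add, two_mul_lyapunov hS.P_transpose hS.lyapunov]
  have hlin : ∀ v, S.P *ᵥ z.xp t ⬝ᵥ (S.Bp * S.Lam) *ᵥ v = n ⬝ᵥ v := fun v => by
    rw [dotProduct_mulVec_eq, mulVec_mulVec, hn, Matrix.mul_assoc S.P, transpose_mul S.P,
      hS.P_transpose]
  rw [hlin, dotProduct_sub]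
  have hφ : euclNorm (Phi z t) ≤ X + S.rMax := (euclNorm_sumElim_le _ _).trans (by gcongr)
  have hθ' : frobNorm (z.ThetaHat t - S.Theta) ≤ K := by
    rw [ThetaHatA_sub_ThetaA'] at hθ
    exact (frobNorm_le_frobNorm_fromCols _ _).trans hθ
  -- Outside the ball of radius `X₁` the constant contribution of the reference input is at most a
  -- multiple of `X`, so it counts as additional gain.
  have hgn : euclNorm g ≤ (K + (K + specNorm S.Kr) * S.rMax / X₁) * X := by
    have h1 : euclNorm g ≤ K * (X + S.rMax) + specNorm S.Kr * S.rMax := by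
      refine (euclNorm_add_le _ _).trans (add_le_add ?_ ?_)
      · refine (euclNorm_mulVec_le_frobNorm _ _).trans ?_
        exact mul_le_mul hθ' hφ (euclNorm_nonneg _) hK.le
      · refine (euclNorm_mulVec_le_specNorm _ _).trans ?_
        gcongr
    have h2 : (K + specNorm S.Kr) * S.rMax ≤ (K + specNorm S.Kr) * S.rMax / X₁ * X := by
      rw [div_mul_eq_mul_div, le_div_iff₀ hX₁]
      exact mul_le_mul_of_nonneg_left hX (by positivity)
    linarith
  have hXD : X * |S.qMin - 2 * S.PB * specNorm S.Kx|
      ≤ S.PB * (S.uMax * K / (specNorm S.Kx + K)) := by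
    rw [xMax, le_div_iff₀ hD, a0] at hXm
    exact hXm
  have key := saturated_decrease (n := WithLp.toLp 2 n) (y := WithLp.toLp 2 y)
    (g := WithLp.toLp 2 g) (q := S.qMin) (p := S.PB) (X := X) (k := specNorm S.Kx)
    (G := K + (K + specNorm S.Kr) * S.rMax / X₁) (K := K) (uMax := S.uMax) (s := s)
    hPB hX0 hk hK (le_add_of_nonneg_right (by positivity)) hS.uMax_pos (abs_pos.1 hD)
    (by rw [← euclNorm_eq_norm]; exact euclNorm_transpose_mulVec_le _ _)
    (by rw [← euclNorm_eq_norm]; exact euclNorm_mulVec_le_specNorm _ _)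
    (by rw [← euclNorm_eq_norm]; exact hgn) hG hXD hs0
    (by rw [← WithLp.toLp_add, ← euclNorm_eq_norm]; exact hs)
  rw [← WithLp.toLp_add, ← WithLp.toLp_smul, EuclideanSpace.inner_toLp_toLp,
    EuclideanSpace.inner_toLp_toLp, star_trivial, dotProduct_comm _ n, dotProduct_comm _ n] at key
  have hQ := hS.Q_posDef.isHermitian.minEig_mul_le (z.xp t)
  rw [← hXdef] at hQ
  have : minEig S.Q = S.qMin := rfl
  rw [this] at hQ
  linarith

/-- The plant state stays in the ball of radius `xMax`. -/
lemma IsTrajectory.euclNorm_xp_lt (hS : S.Standing) (h : S.IsTrajectory z t0 T)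
    (hT : (t0 : EReal) < T)
    (hx : euclNorm (z.xp t0) < S.xMax (S.KMax z t0 T) / S.rho)
    (hV : √(S.V z t0) < S.KBar (S.KMax z t0 T) * √(S.lamMin / S.gam))
    (ht : t ∈ timeDomain t0 T) : euclNorm (z.xp t) < S.xMax (S.KMax z t0 T) := by
  obtain ⟨hPB, hK, hD, hxM, hnx, ⟨i₀⟩⟩ :=
    nondegenerate hS (KMax_nonneg S z t0 T) (euclNorm_nonneg _) hx
  have hKlt := h.KMax_lt hS hT i₀ hV
  have hθ : ∀ t ∈ timeDomain t0 T, _ := fun t ht => h.frobNorm_le_KMax hS (t := t) ht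
  set K := S.KMax z t0 T
  have hρ := one_le_rho hS
  have hρ0 : 0 < S.rho := by linarith
  have hpm := pMin_pos hS
  have hpM : 0 < S.pMax := hpm.trans_le (pMin_le_pMax hS)
  have hk : 0 ≤ specNorm S.Kx := specNorm_nonneg _
  have hκ : 0 ≤ specNorm S.Kr := specNorm_nonneg _
  have hmargin := gain_margin hPB hk hκ hS.rMax_nonneg hS.uMax_pos hρ hD hK rfl rfl hKlt
  set R := √2 / 3 * (S.qMin
      - 2 * (|S.qMin - 2 * S.PB * specNorm S.Kx| * (specNorm S.Kx + K) / K)) with hR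
  set Y := S.xMax K / S.rho with hY
  have hY0 : 0 < Y := div_pos hxM hρ0
  have ha0 : 0 < S.a0 K := by
    have := hS.uMax_pos
    rw [a0]; positivity
  -- At `Y = xMax / ρ` one has `P_B / Y = (ρ / a₀) |q_min - 2 P_B ‖K_x‖|`, which turns the margin
  -- for the gain deviation into the one needed on the annulus.
  have hatY : S.PB * (K + (K + specNorm S.Kr) * S.rMax / Y) < R := by
    refine lt_of_eq_of_lt ?_ hmargin
    change _ = S.PB * K + (K + specNorm S.Kr) * S.rMax
      * (S.rho / S.a0 K * |S.qMin - 2 * S.PB * specNorm S.Kx|)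
    rw [hY, xMax]
    field_simp
  -- By continuity the strict inequality survives for radii slightly below `Y`; this opens the band
  -- of values in which the form decreases.
  obtain ⟨X₁, hX₁, hX₁0, hX₁Y⟩ :
      ∃ X₁, S.PB * (K + (K + specNorm S.Kr) * S.rMax / X₁) < R ∧ 0 < X₁ ∧ X₁ < Y := by
    have hc : ContinuousAt (fun x => S.PB * (K + (K + specNorm S.Kr) * S.rMax / x)) Y :=
      continuousAt_const.mul (continuousAt_const.add
        (continuousAt_const.div continuousAt_id hY0.ne'))
    have h1 := (hc.eventually_lt continuousAt_const hatY).filter_mono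
      (nhdsWithin_le_nhds (s := Set.Iio Y))
    obtain ⟨x, h1, h2⟩ := (h1.and (Ioo_mem_nhdsLT hY0)).exists
    exact ⟨x, h1, h2.1, h2.2⟩
  -- The role of `ρ`: the sublevel set of the form that contains the ball of radius `Y` lies inside
  -- the ball of radius `xMax`.
  have hc₂ : S.pMax * Y ^ 2 = S.pMin * S.xMax K ^ 2 := by
    rw [hY, div_pow, rho, Real.sq_sqrt (by positivity)]
    field_simp
  have hlow : ∀ x, S.pMin * euclNorm x ^ 2 ≤ x ⬝ᵥ S.P *ᵥ x :=
    hS.P_posDef.isHermitian.minEig_mul_le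
  have hup : ∀ x, x ⬝ᵥ S.P *ᵥ x ≤ S.pMax * euclNorm x ^ 2 :=
    hS.P_posDef.isHermitian.le_maxEig_mul
  have sub : ∀ {x : Fin nx → ℝ}, S.pMin * euclNorm x ^ 2 < S.pMax * Y ^ 2 → euclNorm x < S.xMax K := by
    intro x hx
    rw [hc₂] at hx
    exact lt_of_pow_lt_pow_left₀ 2 hxM.le (lt_of_mul_lt_mul_left hx hpm.le)
  obtain ⟨E, hE, hloop⟩ := h.loop
  have hder : ∀ s, ∃ W', s ∈ timeDomain t0 T \ E →
      z.xp s ⬝ᵥ S.P *ᵥ z.xp s ∈ Set.Ioo (S.pMax * X₁ ^ 2) (S.pMax * Y ^ 2) →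
      HasDerivAt (fun s => z.xp s ⬝ᵥ S.P *ᵥ z.xp s) W' s ∧ W' < 0 := by
    intro s
    by_cases hs : s ∈ timeDomain t0 T \ E ∧
      z.xp s ⬝ᵥ S.P *ᵥ z.xp s ∈ Set.Ioo (S.pMax * X₁ ^ 2) (S.pMax * Y ^ 2)
    · obtain ⟨hs1, hs2⟩ := hs
      obtain ⟨W', hW⟩ := (hloop s hs1).exists_hasDerivAt_xp hS hK hPB hD hX₁0 hX₁ (hθ s hs1.1)
        (h.r_le s hs1.1)
        (le_of_lt <| lt_of_pow_lt_pow_left₀ 2 (euclNorm_nonneg _)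
          (lt_of_mul_lt_mul_left (hs2.1.trans_le (hup _)) hpM.le))
        (sub ((hlow _).trans_lt hs2.2)).le
      exact ⟨W', fun _ _ => hW⟩
    · exact ⟨0, fun h1 h2 => absurd ⟨h1, h2⟩ hs⟩
  choose W' hW' using hder
  refine sub ((hlow _).trans_lt ?_)
  refine lt_of_hasDerivAt_neg_in_band (c₁ := S.pMax * X₁ ^ 2) ht.1
    ((h.xp_cont.mono (Icc_subset_timeDomain ht)).quadForm S.P) hE ?_ ?_ fun s hs =>
      hW' s ⟨Icc_subset_timeDomain ht ⟨hs.1.1.le, hs.1.2.le⟩, hs.2⟩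
  · exact mul_lt_mul_of_pos_left (pow_lt_pow_left₀ hX₁Y hX₁0.le two_ne_zero) hpM
  · exact (hup _).trans_lt
      (mul_lt_mul_of_pos_left (pow_lt_pow_left₀ hx (euclNorm_nonneg _) two_ne_zero) hpM)

end Trajectory

end MSACSystem

/-! ### Bounded signals and asymptotics -/

namespace MSACSystem

variable {nx nu : ℕ} {S : MSACSystem nx nu} {z : MSACSignals nx nu} {t : ℝ}

/-- Input-to-state estimate for the stable dynamics `ẋ = A_m x + w`. -/
lemma Standing.exists_iss_bound (hS : S.Standing) :
    ∃ C α : ℝ, 0 < C ∧ 0 < α ∧ ∀ (x w : ℝ → Fin nx → ℝ) (a b ω : ℝ) (E : Set ℝ), a ≤ b → 0 ≤ ω →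
      E.Countable → ContinuousOn x (Set.Icc a b) →
      (∀ t ∈ Set.Ioo a b \ E, HasDerivAt x (S.Am *ᵥ x t + w t) t ∧ euclNorm (w t) ≤ ω) →
      euclNorm (x b) ≤ C * (Real.exp (-α * (b - a)) * euclNorm (x a)) + C * ω := by
  obtain ⟨p₀, hp₀, hlow⟩ := hS.P_posDef.exists_mul_le
  obtain ⟨p₁, hp₁, hup⟩ := hS.P_posDef.isHermitian.exists_le_mul
  obtain ⟨q, hq, hQ⟩ := hS.Q_posDef.exists_mul_le
  set f := frobNorm S.P
  have hf : 0 ≤ f := frobNorm_nonneg _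
  -- Half of the dissipation `q ‖x‖²` gives this decay rate for the form, the other half absorbs the
  -- cross term with `w`. Taking square roots halves the rate to `α / 2`.
  set α := q / (2 * p₁) with hα
  have hα0 : 0 < α := by positivity
  set B := 2 * f ^ 2 / q / α with hB
  have hB0 : 0 ≤ B := by positivity
  set C := 1 + p₁ / p₀ + B / p₀ with hC
  have hC1 : 1 ≤ C := by
    have : 0 ≤ p₁ / p₀ + B / p₀ := by positivity
    linarith
  refine ⟨C, α / 2, by linarith, by positivity, fun x w a b ω E hab hω hE hx hd => ?_⟩
  have hU := le_exp_mul_add_of_hasDerivAt (U := fun t => x t ⬝ᵥ S.P *ᵥ x t)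
    (U' := fun t => 2 * (S.P *ᵥ x t ⬝ᵥ (S.Am *ᵥ x t + w t))) (c := 2 * f ^ 2 / q * ω ^ 2) hab
    (hx.quadForm S.P) hE hα0 (by positivity) fun t ht => by
      obtain ⟨h1, h2⟩ := hd t ht
      refine ⟨h1.quadForm hS.P_transpose, ?_⟩
      rw [dotProduct_add, mul_add, two_mul_lyapunov hS.P_transpose hS.lyapunov]
      have h3 : S.P *ᵥ x t ⬝ᵥ w t ≤ f * euclNorm (x t) * ω :=
        (dotProduct_le _ _).trans (mul_le_mul (euclNorm_mulVec_le_frobNorm _ _) h2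
          (euclNorm_nonneg _) (mul_nonneg hf (euclNorm_nonneg _)))
      have h4 := hQ (x t)
      have h5 : α * (x t ⬝ᵥ S.P *ᵥ x t) ≤ q / 2 * euclNorm (x t) ^ 2 := by
        refine (mul_le_mul_of_nonneg_left (hup (x t)) hα0.le).trans (le_of_eq ?_)
        rw [hα]; field_simp
      have h6 : 2 * (f * euclNorm (x t) * ω)
          ≤ q / 2 * euclNorm (x t) ^ 2 + 2 * f ^ 2 / q * ω ^ 2 := by
        have h7 : 0 ≤ (q * euclNorm (x t) - 2 * f * ω) ^ 2 / (2 * q) := by positivity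
        have h8 : (q * euclNorm (x t) - 2 * f * ω) ^ 2 / (2 * q)
            = q / 2 * euclNorm (x t) ^ 2 + 2 * f ^ 2 / q * ω ^ 2
              - 2 * (f * euclNorm (x t) * ω) := by
          field_simp; ring
        linarith
      linarith
  set g := Real.exp (-(α / 2) * (b - a)) with hg
  have hg0 : 0 < g := Real.exp_pos _
  have hgg : Real.exp (-α * (b - a)) = g ^ 2 := by
    rw [hg, sq, ← Real.exp_add]; congr 1; ring
  rw [hgg, mul_div_right_comm, ← hB] at hU
  have hxa := euclNorm_nonneg (x a)
  set A := euclNorm (x a)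
  have h1 : p₀ * euclNorm (x b) ^ 2 ≤ g ^ 2 * (p₁ * A ^ 2) + B * ω ^ 2 :=
    (hlow _).trans (hU.trans (by gcongr; exact hup _))
  have h2 : euclNorm (x b) ^ 2 ≤ p₁ / p₀ * (g * A) ^ 2 + B / p₀ * ω ^ 2 := by
    have : p₁ / p₀ * (g * A) ^ 2 + B / p₀ * ω ^ 2 = (g ^ 2 * (p₁ * A ^ 2) + B * ω ^ 2) / p₀ := by
      field_simp
    rw [this, le_div_iff₀ hp₀]; linarith
  refine abs_le_of_sq_le_sq' (h2.trans ?_) (by positivity) |>.2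
  have hCC : C ≤ C ^ 2 := by nlinarith
  have h3 : p₁ / p₀ ≤ C ^ 2 := by
    have : 0 ≤ B / p₀ := by positivity
    linarith
  have h4 : B / p₀ ≤ C ^ 2 := by
    have : 0 ≤ p₁ / p₀ := by positivity
    linarith
  have h5 := mul_le_mul_of_nonneg_right h3 (sq_nonneg (g * A))
  have h6 := mul_le_mul_of_nonneg_right h4 (sq_nonneg ω)
  have h7 : 0 ≤ C ^ 2 * ((g * A) * ω) := by positivity
  nlinarith

section Trajectory

variable {t0 : ℝ} {T : EReal}

lemma euclNorm_deltaU_le (hS : S.Standing) (z : MSACSignals nx nu) (t : ℝ) :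
    euclNorm (S.deltaU z t) ≤ 2 * euclNorm (u z t) := by
  have h1 := euclNorm_sub_le (ballSat S.uMax (u z t)) (u z t)
  have h2 := euclNorm_ballSat_le hS.uMax_pos (u z t)
  rw [deltaU]; linarith

lemma IsTrajectory.exists_errU_bound (hS : S.Standing) (h : S.IsTrajectory z t0 T) :
    ∃ M, 0 ≤ M ∧ ∀ t ∈ timeDomain t0 T, euclNorm (errU z t) ≤ M := by
  obtain ⟨p, hp, hP⟩ := hS.P_posDef.exists_mul_le
  refine ⟨√(S.V z t0 / p), Real.sqrt_nonneg _, fun t ht => Real.le_sqrt_of_sq_le ?_⟩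
  rw [le_div_iff₀ hp, mul_comm]
  exact (hP _).trans ((errU_quadForm_le_V hS z t).trans (h.V_le hS ht))

lemma IsTrajectory.exists_XiA_bound (hS : S.Standing) (h : S.IsTrajectory z t0 T) :
    ∃ M, 0 ≤ M ∧ ∀ t ∈ timeDomain t0 T, frobNorm (XiA z t) ≤ M := by
  obtain ⟨l, hl, hle⟩ := exists_pos_le hS.lam_pos
  refine ⟨√(S.gam / min l 1 * S.V z t0) + frobNorm S.ThetaA,
    add_nonneg (Real.sqrt_nonneg _) (frobNorm_nonneg _), fun t ht => ?_⟩
  have h1 : XiA z t = fromCols (z.Xi t - S.Theta) (diagonal (z.lamEps t - S.lam)) + S.ThetaA := by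
    ext i j
    rcases j with j | j
    · simp [XiA, ThetaA]
    · by_cases h : i = j
      · subst h; simp [XiA, ThetaA, Lam]
      · simp [XiA, ThetaA, Lam, diagonal_apply_ne _ h]
  have hm : 0 < min l 1 := lt_min hl one_pos
  have h2 := frobNorm_dev_sq_le hS hm (fun i => (min_le_left _ _).trans (hle i))
    (fun _ => min_le_right _ _) z t
  have h3 := mul_le_mul_of_nonneg_left (h.V_le hS ht) (div_pos hS.gam_pos hm).le
  rw [h1]
  refine (frobNorm_add_le _ _).trans (add_le_add_left (Real.le_sqrt_of_sq_le ?_) _)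
  linarith [sq_nonneg (frobNorm (fromCols (z.ThetaHat t - z.Xi t)
    (diagonal (z.lamHat t - z.lamEps t))))]

lemma IsTrajectory.exists_ThetaHatA_bound (hS : S.Standing) (h : S.IsTrajectory z t0 T) :
    ∃ M, 0 ≤ M ∧ ∀ t ∈ timeDomain t0 T, frobNorm (ThetaHatA z t) ≤ M := by
  refine ⟨S.KMax z t0 T + frobNorm S.ThetaA,
    add_nonneg (KMax_nonneg S z t0 T) (frobNorm_nonneg _), fun t ht => ?_⟩
  have h1 : ThetaHatA z t = (ThetaHatA z t - S.ThetaA) + S.ThetaA := by abel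
  rw [h1]
  exact (frobNorm_add_le _ _).trans (add_le_add_left (h.frobNorm_le_KMax hS ht) _)

lemma IsTrajectory.exists_xm_bound (hS : S.Standing) (h : S.IsTrajectory z t0 T) :
    ∃ M, 0 ≤ M ∧ ∀ t ∈ timeDomain t0 T, euclNorm (z.xm t) ≤ M := by
  obtain ⟨C, α, hC, hα, hiss⟩ := hS.exists_iss_bound
  obtain ⟨E, hE, hloop⟩ := h.loop
  have hB := frobNorm_nonneg S.Bm
  have hr := hS.rMax_nonneg
  have h0 := euclNorm_nonneg (z.xm t0)
  refine ⟨C * euclNorm (z.xm t0) + C * (frobNorm S.Bm * S.rMax), by positivity, fun t ht => ?_⟩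
  have hsub := Icc_subset_timeDomain ht
  refine (hiss z.xm (fun s => S.Bm *ᵥ z.r s) t0 t (frobNorm S.Bm * S.rMax) E ht.1 (by positivity)
    hE (h.xm_cont.mono hsub) fun s hs => ?_).trans ?_
  · have hs' : s ∈ timeDomain t0 T := hsub ⟨hs.1.1.le, hs.1.2.le⟩
    refine ⟨(hloop s ⟨hs', hs.2⟩).reference, (euclNorm_mulVec_le_frobNorm _ _).trans ?_⟩
    exact mul_le_mul_of_nonneg_left (h.r_le s hs') hB
  · have : Real.exp (-α * (t - t0)) ≤ 1 := by
      rw [Real.exp_le_one_iff]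
      have := ht.1
      nlinarith
    have := mul_le_of_le_one_left h0 this
    gcongr

/-- If the plant state is bounded, so are all signals. -/
lemma IsTrajectory.exists_signal_bound (hS : S.Standing) (h : S.IsTrajectory z t0 T) {X : ℝ}
    (hX0 : 0 ≤ X) (hX : ∀ t ∈ timeDomain t0 T, euclNorm (z.xp t) ≤ X) :
    ∃ M, ∀ t ∈ timeDomain t0 T,
      euclNorm (z.xp t) ≤ M ∧ euclNorm (z.xm t) ≤ M ∧ euclNorm (z.eDelta t) ≤ M ∧
      frobNorm (ThetaHatA z t) ≤ M ∧ frobNorm (XiA z t) ≤ M ∧ euclNorm (u z t) ≤ M := by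
  obtain ⟨M₁, h10, h1⟩ := h.exists_xm_bound hS
  obtain ⟨M₂, h20, h2⟩ := h.exists_errU_bound hS
  obtain ⟨M₃, h30, h3⟩ := h.exists_ThetaHatA_bound hS
  obtain ⟨M₄, h40, h4⟩ := h.exists_XiA_bound hS
  have hr := hS.rMax_nonneg
  have h50 : 0 ≤ M₃ * (X + S.rMax) := by positivity
  refine ⟨X + M₁ + M₂ + M₃ + M₄ + M₃ * (X + S.rMax), fun t ht => ?_⟩
  have k0 := hX t ht
  have k1 := h1 t ht
  have k2 := h2 t ht
  have k3 := h3 t ht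
  have k4 := h4 t ht
  have k5 : euclNorm (z.eDelta t) ≤ X + M₁ + M₂ := by
    have e : z.eDelta t = z.xp t - z.xm t - errU z t := by rw [errU, err]; abel
    rw [e]
    have a1 := euclNorm_sub_le (z.xp t - z.xm t) (errU z t)
    have a2 := euclNorm_sub_le (z.xp t) (z.xm t)
    linarith
  have k6 : euclNorm (u z t) ≤ M₃ * (X + S.rMax) := by
    refine (euclNorm_mulVec_le_frobNorm _ _).trans (mul_le_mul
      ((frobNorm_le_frobNorm_fromCols _ _).trans k3) ?_ (euclNorm_nonneg _) h30)
    exact (euclNorm_sumElim_le _ _).trans (add_le_add k0 (h.r_le t ht))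
  refine ⟨?_, ?_, ?_, ?_, ?_, ?_⟩ <;> linarith

lemma abs_lamHat_sub_le (S : MSACSystem nx nu) (z : MSACSignals nx nu) (t : ℝ) (i : Fin nu) :
    |(z.lamHat t - S.lam) i| ≤ frobNorm (ThetaHatA z t - S.ThetaA) := by
  rw [ThetaHatA_sub_ThetaA']
  exact abs_le_frobNorm_fromCols _ _ i

/-- With bounded signals the augmented error vanishes asymptotically. -/
lemma IsTrajectory.tendsto_errU (hS : S.Standing) (h : S.IsTrajectory z t0 ⊤) {M : ℝ}
    (hM : ∀ t, t0 ≤ t → euclNorm (z.xp t) ≤ M ∧ euclNorm (u z t) ≤ M) :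
    Tendsto (fun t => euclNorm (errU z t)) atTop (𝓝 0) := by
  have hdom : timeDomain t0 ⊤ = Set.Ici t0 := by
    ext t; simp [timeDomain, EReal.coe_lt_top]
  obtain ⟨L, c, hL0, hc, hL, hQ⟩ := hS.exists_margin
  obtain ⟨E, hE, hloop⟩ := h.loop
  obtain ⟨p₀, hp₀, hlow⟩ := hS.P_posDef.exists_mul_le
  obtain ⟨p₁, hp₁, hup⟩ := hS.P_posDef.isHermitian.exists_le_mul
  obtain ⟨q, hq, hqle⟩ := hS.Q_posDef.isHermitian.exists_le_mul
  obtain ⟨M₂, h20, h2⟩ := h.exists_errU_bound hS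
  have hθ : ∀ t ∈ timeDomain t0 ⊤, _ := fun t ht => h.frobNorm_le_KMax hS (t := t) ht
  have hK := KMax_nonneg S z t0 ⊤
  have hVc := h.continuousOn_V
  have hec := h.continuousOn_errU
  have hr := h.r_le
  rw [hdom] at hloop h2 hθ hVc hec hr
  set K := S.KMax z t0 ⊤
  have hr0 := hS.rMax_nonneg
  have hM0 : 0 ≤ M := (euclNorm_nonneg _).trans (hM t0 le_rfl).1
  set b := frobNorm (S.P * S.Bp)
  have hb : 0 ≤ b := frobNorm_nonneg _
  set G := L * (K * (M + S.rMax)) + K * (2 * M) with hG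
  have hG0 : 0 ≤ G := by positivity
  have hmis : ∀ t ∈ Set.Ici t0, euclNorm (S.mismatch z t) ≤ G := by
    intro t ht
    refine (euclNorm_sub_le _ _).trans (add_le_add ?_ ?_)
    · refine (euclNorm_mul_le (c := L) (fun i => ?_) hL0 _).trans
        (mul_le_mul_of_nonneg_left ?_ hL0)
      · rw [abs_of_pos (hS.lam_pos i)]; exact (hL i).1
      · refine (euclNorm_mulVec_le_frobNorm _ _).trans (mul_le_mul ?_ ?_ (euclNorm_nonneg _) hK)
        · have := hθ t ht
          rw [ThetaHatA_sub_ThetaA'] at this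
          exact (frobNorm_le_frobNorm_fromCols _ _).trans this
        · exact (euclNorm_sumElim_le _ _).trans (add_le_add (hM t ht).1 (hr t ht))
    · refine (euclNorm_mul_le (fun i => (abs_lamHat_sub_le S z t i).trans (hθ t ht)) hK _).trans
        (mul_le_mul_of_nonneg_left ?_ hK)
      exact (euclNorm_deltaU_le hS z t).trans (by linarith [(hM t ht).2])
  have hVd : ∀ s, ∃ V', s ∈ Set.Ici t0 \ E →
      HasDerivAt (S.V z) V' s ∧ V' ≤ -(c * euclNorm (errU z s) ^ 2) := fun s => by
    by_cases hs : s ∈ Set.Ici t0 \ E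
    · obtain ⟨V', hV⟩ := (hloop s hs).exists_hasDerivAt_V hS hL0 hL hQ
      exact ⟨V', fun _ => hV⟩
    · exact ⟨0, fun h' => absurd h' hs⟩
  choose V' hV' using hVd
  -- The dissipation `c ‖e_u‖²` is weakened to `c / p₁` times the `P`-form of `e_u`, whose
  -- derivative is already known and is bounded below because all signals are bounded.
  have hlim := tendsto_zero_of_dissipation (V := S.V z) (V' := V')
    (φ := fun t => c / p₁ * (errU z t ⬝ᵥ S.P *ᵥ errU z t))
    (φ' := fun t => c / p₁ * (-(errU z t ⬝ᵥ S.Q *ᵥ errU z t)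
      + 2 * (S.drive z t ⬝ᵥ S.mismatch z t)))
    (L := c / p₁ * (q * M₂ ^ 2 + 2 * (b * M₂ * G))) hE hVc
    (continuousOn_const.mul (hec.quadForm S.P)) (fun t _ => V_nonneg hS z t)
    (fun t _ => mul_nonneg (by positivity) ((mul_nonneg hp₀.le (sq_nonneg _)).trans (hlow _)))
    (fun t ht => ⟨(hV' t ht).1, (hV' t ht).2.trans (neg_le_neg ?_)⟩)
    (fun t ht => ⟨((hloop t ht).hasDerivAt_errU_quadForm hS).const_mul _, ?_⟩)
  · have h1 : Tendsto (fun t => √((c / p₁ * (errU z t ⬝ᵥ S.P *ᵥ errU z t)) * (p₁ / c / p₀))) atTop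
        (𝓝 0) := by
      have := (hlim.mul_const (p₁ / c / p₀)).sqrt
      simpa using this
    refine squeeze_zero (fun t => euclNorm_nonneg _) (fun t => Real.le_sqrt_of_sq_le ?_) h1
    have e : c / p₁ * (errU z t ⬝ᵥ S.P *ᵥ errU z t) * (p₁ / c / p₀)
        = (errU z t ⬝ᵥ S.P *ᵥ errU z t) / p₀ := by field_simp
    rw [e, le_div_iff₀ hp₀, mul_comm]
    exact hlow _
  · have := mul_le_mul_of_nonneg_left (hup (errU z t)) (show 0 ≤ c / p₁ by positivity)
    refine this.trans (le_of_eq ?_)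
    field_simp
  · rw [← mul_neg]
    refine mul_le_mul_of_nonneg_left ?_ (by positivity)
    have he := h2 t ht.1
    have h1 : errU z t ⬝ᵥ S.Q *ᵥ errU z t ≤ q * M₂ ^ 2 :=
      (hqle _).trans (mul_le_mul_of_nonneg_left (pow_le_pow_left₀ (euclNorm_nonneg _) he 2) hq.le)
    have h3 : |S.drive z t ⬝ᵥ S.mismatch z t| ≤ b * M₂ * G := by
      refine (abs_dotProduct_le _ _).trans (mul_le_mul ?_ (hmis t ht.1) (euclNorm_nonneg _)
        (by positivity))
      exact (euclNorm_drive_le hS _).trans (mul_le_mul_of_nonneg_left he hb)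
    linarith [(abs_le.1 h3).1]

/-- Under the smallness condition the gain deviation is bounded by plant data only. -/
lemma IsTrajectory.KMax_le (hS : S.Standing) (h : S.IsTrajectory z t0 T) (hT : (t0 : EReal) < T)
    (hx : euclNorm (z.xp t0) < S.xMax (S.KMax z t0 T) / S.rho)
    (hV : √(S.V z t0) < S.KBar (S.KMax z t0 T) * √(S.lamMin / S.gam)) :
    S.KMax z t0 T ≤ S.qMin / S.PB := by
  obtain ⟨hPB, hK, hD, -, hnx, ⟨i₀⟩⟩ :=
    nondegenerate hS (KMax_nonneg S z t0 T) (euclNorm_nonneg _) hx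
  have hlt := h.KMax_lt hS hT i₀ hV
  set K := S.KMax z t0 T
  have hq := qMin_pos hS
  have hκ : 0 ≤ specNorm S.Kr := specNorm_nonneg _
  have hk : 0 ≤ specNorm S.Kx := specNorm_nonneg _
  have hρ := one_le_rho hS
  have hu := hS.uMax_pos
  have hr := hS.rMax_nonneg
  have ha : 0 < S.a0 K := by rw [a0]; positivity
  have hB : S.KBar K ≤ S.qMin / (3 * S.PB) := by
    rw [KBar]
    have h1 : 0 ≤ S.rho / S.a0 K * (3 * specNorm S.Kr * S.rMax + 2 * S.uMax)
      * |S.qMin - 2 * S.PB * specNorm S.Kx| := by positivity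
    have h2 : 0 ≤ 3 * S.rho / S.a0 K * (S.rMax + 1) * |S.qMin - 2 * S.PB * specNorm S.Kx| := by
      positivity
    exact div_le_div₀ hq.le (by linarith) (by positivity) (by linarith)
  have hs : √2 ≤ 3 := by rw [Real.sqrt_le_left (by norm_num)]; norm_num
  calc K ≤ √2 * S.KBar K := hlt.le
    _ ≤ √2 * (S.qMin / (3 * S.PB)) := by gcongr
    _ ≤ 3 * (S.qMin / (3 * S.PB)) := by gcongr
    _ = S.qMin / S.PB := by field_simp

end Trajectory

end MSACSystem

end

/-! ### Assembly of the theorem -/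

open MSACSystem in
theorem theorem2 {nx nu : ℕ} (S : MSACSystem nx nu) (hS : S.Standing) :
    ∃ C : ℝ, 0 ≤ C ∧
      ∀ (t0 : ℝ) (T : EReal) (z : MSACSignals nx nu),
        (t0 : EReal) < T → S.IsTrajectory z t0 T →
        -- the supremum that defines `K_max` is finite
        BddAbove ((fun t => frobNorm (MSACSystem.ThetaHatA z t - S.ThetaA)) '' timeDomain t0 T) ∧
        (euclNorm (z.xp t0) < S.xMax (S.KMax z t0 T) / S.rho →
          √(S.V z t0) < S.KBar (S.KMax z t0 T) * √(S.lamMin / S.gam) →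
          -- all signals are bounded
          (∃ M : ℝ, ∀ t ∈ timeDomain t0 T,
            euclNorm (z.xp t) ≤ M ∧ euclNorm (z.xm t) ≤ M ∧ euclNorm (z.eDelta t) ≤ M ∧
            frobNorm (MSACSystem.ThetaHatA z t) ≤ M ∧ frobNorm (MSACSystem.XiA z t) ≤ M ∧
            euclNorm (MSACSystem.u z t) ≤ M) ∧
          (∀ t ∈ timeDomain t0 T, euclNorm (z.xp t) < S.xMax (S.KMax z t0 T)) ∧
          -- the tracking error is of the order of the saturation deficiency
          ∃ ε : ℝ → ℝ, Tendsto ε atTop (𝓝 0) ∧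
            ∀ t ∈ timeDomain t0 T,
              euclNorm (MSACSystem.err z t)
                ≤ ε t + C * ⨆ τ : Set.Icc t0 t, euclNorm (S.deltaU z τ)) := by
  obtain ⟨C, α, hC, hα, hiss⟩ := hS.exists_iss_bound
  have hb : 0 ≤ frobNorm S.Bp := frobNorm_nonneg _
  -- A bound for every `|λ̂_i|` that does not involve the trajectory: `λ_i` plus the bound on
  -- `K_max`. The absolute value gives `ℓ ≥ 0` before any nondegeneracy is known.
  set ℓ := ∑ i, S.lam i + |S.qMin / S.PB| with hℓ
  have hℓ0 : 0 ≤ ℓ :=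
    add_nonneg (Finset.sum_nonneg fun i _ => (hS.lam_pos i).le) (abs_nonneg _)
  refine ⟨C * (frobNorm S.Bp * ℓ), by positivity, fun t0 T z hT h => ⟨h.bddAbove_frobNorm hS,
    fun hx hV => ?_⟩⟩
  have hxp : ∀ t ∈ timeDomain t0 T, euclNorm (z.xp t) < S.xMax (S.KMax z t0 T) :=
    fun t ht => h.euclNorm_xp_lt hS hT hx hV ht
  obtain ⟨-, -, -, hX0, -, -⟩ := nondegenerate hS (KMax_nonneg S z t0 T) (euclNorm_nonneg _) hx
  obtain ⟨M, hM⟩ := h.exists_signal_bound hS hX0.le fun t ht => (hxp t ht).le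
  refine ⟨⟨M, hM⟩, hxp, ?_⟩
  have hsup0 : ∀ t, 0 ≤ ⨆ τ : Set.Icc t0 t, euclNorm (S.deltaU z τ) :=
    fun t => Real.iSup_nonneg fun _ => euclNorm_nonneg _
  obtain ⟨E, hE, hloop⟩ := h.loop
  have heΔ : ∀ t ∈ timeDomain t0 T, euclNorm (z.eDelta t)
      ≤ C * (Real.exp (-α * (t - t0)) * euclNorm (z.eDelta t0))
        + C * (frobNorm S.Bp * ℓ) * ⨆ τ : Set.Icc t0 t, euclNorm (S.deltaU z τ) := by
    intro t ht
    have hsub := Icc_subset_timeDomain ht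
    have hbdd : BddAbove (Set.range fun τ : Set.Icc t0 t => euclNorm (S.deltaU z τ)) := by
      refine ⟨2 * M, ?_⟩
      rintro _ ⟨τ, rfl⟩
      have := (hM τ (hsub τ.2)).2.2.2.2.2
      exact (euclNorm_deltaU_le hS z τ).trans (by linarith)
    refine (hiss z.eDelta (fun s => (S.Bp * diagonal (z.lamHat s)) *ᵥ S.deltaU z s) t0 t
      (frobNorm S.Bp * ℓ * ⨆ τ : Set.Icc t0 t, euclNorm (S.deltaU z τ)) E ht.1
      (mul_nonneg (mul_nonneg hb hℓ0) (hsup0 t)) hE (h.eDelta_cont.mono hsub)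
      fun s hs => ?_).trans (le_of_eq (by ring))
    have hs' : s ∈ Set.Icc t0 t := ⟨hs.1.1.le, hs.1.2.le⟩
    refine ⟨(hloop s ⟨hsub hs', hs.2⟩).auxiliary, ?_⟩
    rw [← mulVec_mulVec, diagonal_mulVec_eq_mul, mul_assoc]
    refine (euclNorm_mulVec_le_frobNorm _ _).trans (mul_le_mul_of_nonneg_left ?_ hb)
    refine (euclNorm_mul_le (c := ℓ) (fun i => ?_) hℓ0 _).trans
      (mul_le_mul_of_nonneg_left (le_ciSup hbdd ⟨s, hs'⟩) hℓ0)
    have h1 := (abs_lamHat_sub_le S z s i).trans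
      ((h.frobNorm_le_KMax hS (hsub hs')).trans (h.KMax_le hS hT hx hV))
    have h2 := Finset.single_le_sum (f := S.lam) (fun i _ => (hS.lam_pos i).le) (Finset.mem_univ i)
    have h3 := hS.lam_pos i
    rw [Pi.sub_apply, abs_le] at h1
    have h4 := le_abs_self (S.qMin / S.PB)
    rw [abs_le]
    constructor <;> linarith
  rcases eq_or_ne T ⊤ with rfl | hTtop
  · refine ⟨fun t => euclNorm (errU z t)
      + C * (Real.exp (-α * (t - t0)) * euclNorm (z.eDelta t0)), ?_, fun t ht => ?_⟩
    · have h1 := h.tendsto_errU hS (M := M) fun t ht => by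
        have := hM t ⟨ht, EReal.coe_lt_top t⟩
        exact ⟨this.1, this.2.2.2.2.2⟩
      have h2 : Tendsto (fun t => Real.exp (-α * (t - t0))) atTop (𝓝 0) := by
        refine Real.tendsto_exp_atBot.comp ?_
        exact (tendsto_atTop_add_const_right atTop (-t0) tendsto_id).const_mul_atTop_of_neg
          (neg_lt_zero.2 hα)
      simpa using h1.add ((h2.mul_const (euclNorm (z.eDelta t0))).const_mul C)
    · have h1 : err z t = errU z t + z.eDelta t := by rw [errU]; abel
      have h2 := euclNorm_add_le (errU z t) (z.eDelta t)
      rw [← h1] at h2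
      linarith [heΔ t ht]
  · lift T to ℝ using ⟨hTtop, ne_bot_of_gt hT⟩
    -- For finite `T` the limit of `ε` concerns only times outside the domain, so the error itself,
    -- cut off at `T`, serves.
    refine ⟨fun t => if t < T then euclNorm (err z t) else 0, ?_, fun t ht => ?_⟩
    · refine tendsto_const_nhds.congr' ?_
      filter_upwards [eventually_ge_atTop T] with t ht
      rw [if_neg (not_lt.2 ht)]
    · have h1 : t < T := EReal.coe_lt_coe_iff.1 ht.2
      simp only [if_pos h1]
      exact le_add_of_nonneg_right (mul_nonneg (by positivity) (hsup0 t))
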